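/- Consider an episodic MDP with finite state space $\mathcal S$ and finite action space $\mathcal A$, fixed initial state $S_0$, absorbing terminal state $0$, transition probabilities $p(\cdot\mid s,a)$, reward $r:\mathcal S\times\mathcal A\times\mathcal S\to[-r_{\max},r_{\max}]$ with $r_{\max}>0$, and discount factor $\gamma\in(0,1)$. Let $\{\pi_\theta(a\mid s)\}_{\theta\in\mathbb R^d}$ be stochastic policies with $\pi_\theta(a\mid s)>0$ and $\theta\mapsto\log\pi_\theta(a\mid s)$ twice differentiable, such that for all $\theta,a,s$ $$\|\nabla\log\pi_\theta(a\mid s)\|\le M_d,\qquad \|\nabla^2\log\pi_\theta(a\mid s)\|\le M_h .$$ Let $T$ be the first time the state $0$ is reached, and suppose that for every $\theta$, $T\le M_e$ almost surely under $\pi_\theta$. Let $g:[0,1]\to[0,1]$ be non-decreasing with $g(0)=0$, $g(1)=1$, twice differentiable on $(0,1)$ with $|g'|\le M_{g'}$ and $|g''|\le M_{g''}$ there, and right-differentiable at $0$ (write $g'(0)$ for this right derivative). All constants $M_d,M_h,M_e,M_{g'},M_{g''}$ are positive. Let $R^\theta=\sum_{t=0}^{T-1}\gamma^t r(S_t,A_t,S_{t+1})$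 be the discounted reward of an episode under $\pi_\theta$, $F_{R^\theta}$ its CDF, $M_r=r_{\max}/(1-\gamma)$, and $$\rho_g(\theta)=\int_{-M_r}^0\big(g(1-F_{R^\theta}(x))-1\big)dx+\int_0^{M_r}g(1-F_{R^\theta}(x))\,dx,\qquad \rho_g^*=\sup_{\theta\in\mathbb R^d}\rho_g(\theta).$$ For $m$ independent episodes under $\pi_\theta$ with rewards $R_i$, lengths $T^i$, states $S^i_t$ and actions $A^i_t$, put $$G^m(x)=\frac1m\sum_{i=1}^m\mathbf 1\{R_i\le x\},\qquad \widehat\nabla G^m(x)=\frac1m\sum_{i=1}^m\mathbf 1\{R_i\le x\}\sum_{t=0}^{T^i-1}\nabla\log\pi_\theta(A^i_t\mid S^i_t),$$ $$\widehat\nabla\rho_g(\theta)=-\int_{-M_r}^{M_r}g'(1-G^m(x))\,\widehat\nabla G^m(x)\,dx$$ (where $G^m(x)=0$ the integrand is $0$, since $\widehat\nabla G^m(x)=0$ there). The on-policy algorithm starts at a fixed $\theta_0\in\mathbb R^d$; at each iteration it draws a fresh batch of $m$ independent episodes from $\pi_{\theta_k}$ and sets $\theta_{k+1}=\theta_k+\alpha\,\widehat\nabla\rho_g(\theta_k)$.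 Its output after $N\ge1$ iterations is $\theta_R$ with $R$ uniform on $\{1,\dots,N\}$, independent of the iterates. Then $\rho_g$ is differentiable and bounded above, and with $$L_{\rho'}=2M_rM_e\big(M_hM_{g'}+M_eM_d^2(M_{g'}+M_{g''})\big),$$ $$C=2(\rho_g^*-\rho_g(\theta_0))+4M_r^2M_e^2M_d^2\big(M_{g'}^2L_{\rho'}+8(e^2M_{g'}^2+M_{g''}^2)\big),$$ the following holds. For every $N\ge1$, if $\alpha=1/\sqrt N$ and $m=\lceil\sqrt N\rceil$ (so $m=\sqrt N$ when $N$ is a perfect square), then $$\mathbb E\|\nabla\rho_g(\theta_R)\|^2\le\frac{C}{\sqrt N}.$$ Consequently, for every $\varepsilon>0$ and every $N\ge1$ with $N\ge C^2/\varepsilon^2$, the output $\theta_R$ with these choices is an $\varepsilon$-stationary point, i.e. $\mathbb E\|\nabla\rho_g(\theta_R)\|^2\le\varepsilon$; thus $O(1/\varepsilon^2)$ iterations suffice. -/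

import Mathlib

open scoped ENNReal
open Classical in
/-- The law of `m` independent draws from `p`. -/
noncomputable def iidLaw {α : Type*} (p : PMF α) (m : ℕ) : PMF (Fin m → α) :=
  ⟨fun w => ∏ i, p (w i), by
    rw [ENNReal.summable.hasSum_iff]
    induction m with
    | zero => rw [tsum_eq_single default (fun b hb => (hb (Subsingleton.elim _ _)).elim)]; simp
    | succ m ih =>
      rw [← (Fin.consEquiv (fun _ : Fin (m + 1) => α)).tsum_eq, ENNReal.tsum_prod']
      simp only [Fin.consEquiv_apply, Fin.prod_univ_succ, Fin.cons_zero, Fin.cons_succ,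
        ENNReal.tsum_mul_left, ih, mul_one, p.tsum_coe]⟩

/-- The parameter space `ℝ^d` with its Euclidean norm. -/
abbrev Param (d : ℕ) : Type := EuclideanSpace ℝ (Fin d)

/-- An episodic Markov decision process: transition law `trans s a` of the next state, reward
`reward s a s'`, fixed initial state, and a terminal absorbing state. -/
structure EpisodicMDP (S A : Type*) where
  trans : S → A → PMF S
  reward : S → A → S → ℝ
  start : S
  term : S
  absorbing : ∀ a, trans term a = PMF.pure term

/-- A finite episode: its length `n`, its states `S_0, …, S_n`, its actions `A_0, …, A_{n-1}`. -/
abbrev Episode (S A : Type*) : Type _ := Σ n : ℕ, (Fin (n + 1) → S) × (Fin n → A)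

namespace EpisodicMDP

variable {S A : Type*} (M : EpisodicMDP S A) (q : S → PMF A)

open Classical in
/-- Probability, under the stationary policy `q` and initial state `s₀`, that the process reaches
the terminal state for the first time at time `n` along the given states and actions:
`∏_{t<n} q(A_t | S_t) p(S_{t+1} | S_t, A_t)` if the path starts at `s₀` and visits the terminal
state exactly at its last time, and `0` otherwise. -/
noncomputable def episodeProb (s₀ : S) (ω : Episode S A) : ℝ≥0∞ :=
  if ω.2.1 0 = s₀ ∧ ∀ t, ω.2.1 t = M.term ↔ t = Fin.last ω.1 then
    ∏ t : Fin ω.1, q (ω.2.1 t.castSucc) (ω.2.2 t) *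
      M.trans (ω.2.1 t.castSucc) (ω.2.2 t) (ω.2.1 t.succ)
  else 0

open Classical in
theorem episodeProb_cons {n : ℕ} (s x : S) (τ : Fin (n + 1) → S) (a : A) (β : Fin n → A) :
    M.episodeProb q s ⟨n + 1, Fin.cons x τ, Fin.cons a β⟩ ≤
      (if x = s then q s a else 0) * ∑' s', M.trans s a s' * M.episodeProb q s' ⟨n, τ, β⟩ := by
  refine le_trans ?_ (mul_le_mul_right (ENNReal.le_tsum (τ 0)) _)
  unfold episodeProb
  by_cases h : (Fin.cons x τ : Fin (n + 2) → S) 0 = s ∧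
      ∀ t, (Fin.cons x τ : Fin (n + 2) → S) t = M.term ↔ t = Fin.last (n + 1)
  · have h1 : x = s := by simpa using h.1
    have h2 : ∀ t, τ t = M.term ↔ t = Fin.last n := by
      intro t
      have := h.2 t.succ
      rwa [Fin.cons_succ, ← Fin.succ_last, Fin.succ_inj] at this
    subst h1
    simp only [h2]
    rw [if_pos (by simpa using h.2)]
    simp [Fin.prod_univ_succ, mul_assoc]
  · rw [if_neg h]; exact zero_le

open Classical in
theorem tsum_episodeProb_succ_le (n : ℕ) (s : S) :
    ∑' e : (Fin (n + 2) → S) × (Fin (n + 1) → A), M.episodeProb q s ⟨n + 1, e⟩ ≤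
      ∑' a, q s a * ∑' s', M.trans s a s' *
        ∑' e : (Fin (n + 1) → S) × (Fin n → A), M.episodeProb q s' ⟨n, e⟩ := by
  rw [← (((Fin.consEquiv (fun _ : Fin (n + 2) => S))).prodCongr
    ((Fin.consEquiv (fun _ : Fin (n + 1) => A)))).tsum_eq]
  simp only [Equiv.prodCongr_apply, ENNReal.tsum_prod', Prod.map]
  calc _ ≤ ∑' (x : S) (τ : Fin (n + 1) → S) (a : A) (β : Fin n → A),
        (if x = s then q s a else 0) *
          ∑' s', M.trans s a s' * M.episodeProb q s' ⟨n, τ, β⟩ :=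
        ENNReal.tsum_le_tsum fun x => ENNReal.tsum_le_tsum fun τ =>
          ENNReal.tsum_le_tsum fun a => ENNReal.tsum_le_tsum fun β =>
            M.episodeProb_cons q s x τ a β
    _ = _ := by
        rw [tsum_eq_single s (fun x hx => by simp [hx])]
        simp only [if_true]
        rw [ENNReal.tsum_comm]
        refine tsum_congr fun a => ?_
        simp only [ENNReal.tsum_mul_left]
        congr 1
        simp only [← ENNReal.tsum_mul_left]
        calc _ = ∑' (τ : Fin (n + 1) → S) (s' : S) (β : Fin n → A),
              M.trans s a s' * M.episodeProb q s' ⟨n, τ, β⟩ :=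
              tsum_congr fun τ => ENNReal.tsum_comm
          _ = _ := ENNReal.tsum_comm

theorem tsum_episodeProb_term_succ (n : ℕ) :
    ∑' e : (Fin (n + 2) → S) × (Fin (n + 1) → A), M.episodeProb q M.term ⟨n + 1, e⟩ = 0 := by
  refine ENNReal.tsum_eq_zero.2 fun e => if_neg fun h => ?_
  exact absurd ((h.2 0).1 h.1) (Fin.last_pos.ne)

open Classical in
theorem tsum_episodeProb_zero (s : S) :
    ∑' e : (Fin 1 → S) × (Fin 0 → A), M.episodeProb q s ⟨0, e⟩ ≤ if s = M.term then 1 else 0 := by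
  rw [tsum_eq_single (fun _ => s, Fin.elim0)]
  · unfold episodeProb
    split_ifs with h h' h'
    · simp
    · exact absurd (h.1.symm.trans ((h.2 0).2 rfl)) h'
    · exact zero_le
    · exact le_rfl
  · rintro ⟨e, f⟩ he
    refine if_neg fun h => he ?_
    refine Prod.ext (funext fun t => ?_) (Subsingleton.elim _ _)
    rw [Subsingleton.elim t 0]; exact h.1

open Classical in
theorem sum_range_episodeProb_le_one (n : ℕ) : ∀ s : S,
    ∑ k ∈ Finset.range n,
      ∑' e : (Fin (k + 1) → S) × (Fin k → A), M.episodeProb q s ⟨k, e⟩ ≤ 1 := by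
  induction n with
  | zero => simp
  | succ n ih =>
    intro s
    rw [Finset.sum_range_succ']
    have h0 := M.tsum_episodeProb_zero q s
    by_cases hs : s = M.term
    · subst hs
      rw [Finset.sum_eq_zero fun k _ => M.tsum_episodeProb_term_succ q k, zero_add]
      simpa using h0
    · rw [if_neg hs] at h0
      calc _ ≤ (∑ k ∈ Finset.range n, ∑' a, q s a * ∑' s', M.trans s a s' *
            ∑' e : (Fin (k + 1) → S) × (Fin k → A), M.episodeProb q s' ⟨k, e⟩) + 0 :=
            add_le_add (Finset.sum_le_sum fun k _ => M.tsum_episodeProb_succ_le q k s) h0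
        _ = ∑' a, q s a * ∑' s', M.trans s a s' * ∑ k ∈ Finset.range n,
            ∑' e : (Fin (k + 1) → S) × (Fin k → A), M.episodeProb q s' ⟨k, e⟩ := by
            rw [add_zero, ← Summable.tsum_finsetSum fun _ _ => ENNReal.summable]
            refine tsum_congr fun a => ?_
            rw [← Finset.mul_sum, ← Summable.tsum_finsetSum fun _ _ => ENNReal.summable]
            simp only [Finset.mul_sum]
        _ ≤ ∑' a, q s a * ∑' s', M.trans s a s' * 1 :=
            ENNReal.tsum_le_tsum fun a => mul_le_mul_right
              (ENNReal.tsum_le_tsum fun s' => mul_le_mul_right (ih s') _) _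
        _ = 1 := by simp [PMF.tsum_coe]

theorem tsum_episodeProb_le_one (s : S) : ∑' ω, M.episodeProb q s ω ≤ 1 := by
  rw [ENNReal.tsum_sigma']
  exact ENNReal.tsum_le_of_sum_range_le fun n => M.sum_range_episodeProb_le_one q n s

/-- The law of an episode under the policy `q`: `some ω` is the episode `ω` run until the terminal
state is first reached; `none` is the event that the terminal state is never reached, which
carries the remaining probability. -/
noncomputable def episodeLaw : PMF (Option (Episode S A)) :=
  ⟨fun o => o.elim (1 - ∑' ω, M.episodeProb q M.start ω) (M.episodeProb q M.start), by
    rw [ENNReal.summable.hasSum_iff, ← (Equiv.optionEquivSumPUnit.{0} _).symm.tsum_eq,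
      Summable.tsum_sum ENNReal.summable ENNReal.summable, add_comm]
    simp only [Equiv.optionEquivSumPUnit_symm_inl, Equiv.optionEquivSumPUnit_symm_inr,
      Option.elim_some, Option.elim_none, tsum_fintype, Finset.univ_unique, Finset.sum_singleton]
    exact tsub_add_cancel_of_le (M.tsum_episodeProb_le_one q M.start)⟩

/-- The length `T` of an episode, `∞` if the terminal state is never reached. -/
noncomputable def episodeLength : Option (Episode S A) → ℝ≥0∞
  | none => ⊤
  | some ω => (ω.1 : ℝ≥0∞)

/-- The cumulative discounted reward `R = ∑_{t<T} γ^t r(S_t, A_t, S_{t+1})` of an episode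
(by convention `0` if the terminal state is never reached). -/
noncomputable def discountedReward (γ : ℝ) : Option (Episode S A) → ℝ
  | none => 0
  | some ω => ∑ t : Fin ω.1,
      γ ^ (t : ℕ) * M.reward (ω.2.1 t.castSucc) (ω.2.2 t) (ω.2.1 t.succ)

/-- The CDF of the cumulative discounted reward under the policy `q`. -/
noncomputable def rewardCDF (γ : ℝ) (x : ℝ) : ℝ :=
  ProbabilityTheory.cdf ((M.episodeLaw q).map (M.discountedReward γ)).toMeasure x

end EpisodicMDP

/-- `g : [0,1] → [0,1]` is a distortion function (values outside `[0,1]` are irrelevant). -/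
structure IsDistortion (g : ℝ → ℝ) : Prop where
  mono : MonotoneOn g (Set.Icc 0 1)
  zero : g 0 = 0
  one : g 1 = 1

/-- The derivative of `g` on `[0,1]`: two-sided inside, the right derivative `g'₊(0)` at `0`. -/
noncomputable def distDeriv (g : ℝ → ℝ) (t : ℝ) : ℝ := derivWithin g (Set.Icc 0 1) t

section DRM

variable {S A : Type*} {d : ℕ} (M : EpisodicMDP S A) (π : Param d → S → PMF A) (g : ℝ → ℝ)
  (γ Mr : ℝ)

/-- The distortion risk measure `ρ_g(θ)` of the cumulative reward under the policy `π θ`. -/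
noncomputable def drm (θ : Param d) : ℝ :=
  (∫ x in (-Mr)..0, (g (1 - M.rewardCDF (π θ) γ x) - 1)) +
    ∫ x in (0 : ℝ)..Mr, g (1 - M.rewardCDF (π θ) γ x)

/-- `log π_θ(a | s)` as a function of `θ`. -/
noncomputable def logPolicy (s : S) (a : A) (θ : Param d) : ℝ := Real.log (π θ s a).toReal

/-- `∑_{t<T} ∇ log π_θ(A_t | S_t)` along an episode. -/
noncomputable def episodeScore (θ : Param d) : Option (Episode S A) → Param d
  | none => 0
  | some ω => ∑ t : Fin ω.1, gradient (logPolicy π (ω.2.1 t.castSucc) (ω.2.2 t)) θ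

open Classical in
/-- The empirical distribution function of the rewards of a batch of `m` episodes. -/
noncomputable def empCDF {m : ℕ} (w : Fin m → Option (Episode S A)) (x : ℝ) : ℝ :=
  (m : ℝ)⁻¹ * ∑ i, if M.discountedReward γ (w i) ≤ x then 1 else 0

open Classical in
/-- The likelihood-ratio estimate of the gradient of the CDF from a batch of `m` episodes. -/
noncomputable def empGradCDF {m : ℕ} (θ : Param d) (w : Fin m → Option (Episode S A)) (x : ℝ) :
    Param d :=
  (m : ℝ)⁻¹ • ∑ i, if M.discountedReward γ (w i) ≤ x then episodeScore π θ (w i) else 0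

/-- The on-policy estimate of `∇ ρ_g(θ)` from a batch of `m` episodes. -/
noncomputable def drmGradEstimate {m : ℕ} (θ : Param d) (w : Fin m → Option (Episode S A)) :
    Param d :=
  -∫ x in (-Mr)..Mr, distDeriv g (1 - empCDF M γ w x) • empGradCDF M π γ θ w x

/-- The law of the `k`-th iterate of the on-policy algorithm: from `θ_k`, draw `m` fresh
independent episodes from `π_{θ_k}` and set `θ_{k+1} = θ_k + α · (gradient estimate at θ_k)`. -/
noncomputable def iterateLaw (α : ℝ) (m : ℕ) (θ₀ : Param d) : ℕ → PMF (Param d)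
  | 0 => PMF.pure θ₀
  | k + 1 => (iterateLaw α m θ₀ k).bind fun θ =>
      (iidLaw (M.episodeLaw (π θ)) m).map fun w => θ + α • drmGradEstimate M π g γ Mr θ w

/-- The law of the output `θ_R`, `R` uniform on `{1, …, N}`, independent of the iterates. -/
noncomputable def outputLaw (α : ℝ) (m : ℕ) (θ₀ : Param d) (N : ℕ) (hN : 1 ≤ N) :
    PMF (Param d) :=
  (PMF.uniformOfFinset (Finset.Icc 1 N) (Finset.nonempty_Icc.2 hN)).bind
    (iterateLaw M π g γ Mr α m θ₀)

/-- `E ‖∇ ρ_g(θ)‖²` for a random parameter `θ` with (discrete) law `μ`. -/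
noncomputable def meanSqGrad (μ : PMF (Param d)) : ℝ≥0∞ :=
  ∑' θ, μ θ * ENNReal.ofReal (‖gradient (drm M π g γ Mr) θ‖ ^ 2)

/-- A random parameter with law `μ` is an `ε`-stationary point: `E ‖∇ ρ_g(θ)‖² ≤ ε`. -/
def IsStationaryPoint (ε : ℝ) (μ : PMF (Param d)) : Prop :=
  meanSqGrad M π g γ Mr μ ≤ ENNReal.ofReal ε

end DRM

/-! Every policy charges every action, so all parameters give the same set of possible episodes;
bounded length and finite `S`, `A` make this set finite. The problem becomes one about a smooth
family of positive weights on a finite set (`LikelihoodModel`), with score bounded by `Me * Md` and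
Hessian of the log-likelihood by `Me * Mh` (`exists_likelihoodModel`).

The CDF at `x` is the probability of the event `{R ≤ x}`, and only finitely many events occur as `x`
varies. The integral defining the risk measure is thus, up to a constant, a finite sum over events
weighted by lengths of level sets, with total weight `2 * Mr` (`drm_eq_risk`); no differentiation
under an integral is needed. The estimator is the same sum with empirical quantities. The empty and
full events contribute constants, and every other event has probability in `(0, 1)`, where `g` is
smooth. This gives an `L`-Lipschitz gradient (`norm_riskGrad_sub_le`).

The estimator is biased, but `iidExpectation_gap_step_le` needs only its mean square error: if `α *
L ≤ 1`, ascent along `h` gains at least `α/2 * ‖∇‖² - α/2 * ‖h - ∇‖²`. The variance of an i.i.d.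
mean, applied event by event, bounds that error by a constant over `m`. Telescoping over the
iterates gives the rate when `L ≤ √N`; otherwise the uniform bound on the gradient already suffices,
because `C` contains a multiple of `L`. -/

/-! ### Integrals over levels as finite sums over sublevel events. -/

section SublevelWeight

variable {Ω : Type*} [Fintype Ω]

open Classical in
/-- The finite set of outcomes whose value under `R` is at most `x`. -/
noncomputable def sublevel (R : Ω → ℝ) (x : ℝ) : Finset Ω := Finset.univ.filter fun ω => R ω ≤ x

theorem mem_sublevel {R : Ω → ℝ} {x : ℝ} {ω : Ω} : ω ∈ sublevel R x ↔ R ω ≤ x := by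
  simp [sublevel]

/-- Membership of each outcome restricts the level to a half-line, and there are finitely many
outcomes. -/
theorem measurableSet_sublevel_eq (R : Ω → ℝ) (U : Finset Ω) :
    MeasurableSet {x | sublevel R x = U} := by
  have : {x | sublevel R x = U} = ⋂ ω, {x | R ω ≤ x ↔ ω ∈ U} := by
    ext x
    simp [Finset.ext_iff, mem_sublevel]
  rw [this]
  refine MeasurableSet.iInter fun ω => ?_
  by_cases h : ω ∈ U
  · have : {x | R ω ≤ x ↔ ω ∈ U} = Set.Ici (R ω) := by ext; simp [h]
    exact this ▸ measurableSet_Ici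
  · have : {x | R ω ≤ x ↔ ω ∈ U} = Set.Iio (R ω) := by ext; simp [h]
    exact this ▸ measurableSet_Iio

/-- The length of the set of levels `x ∈ (a, b]` at which the sublevel set of `R` is `U`. -/
noncomputable def sublevelWeight (R : Ω → ℝ) (a b : ℝ) (U : Finset Ω) : ℝ :=
  MeasureTheory.volume.real (Set.Ioc a b ∩ {x | sublevel R x = U})

theorem sublevelWeight_nonneg (R : Ω → ℝ) (a b : ℝ) (U : Finset Ω) :
    0 ≤ sublevelWeight R a b U := MeasureTheory.measureReal_nonneg

variable {E : Type*} [NormedAddCommGroup E]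

open Classical in
theorem comp_sublevel_eq_sum (R : Ω → ℝ) (Φ : Finset Ω → E) (x : ℝ) :
    Φ (sublevel R x) =
      ∑ U : Finset Ω, Set.indicator {x | sublevel R x = U} (fun _ => Φ U) x := by
  rw [Finset.sum_eq_single (sublevel R x)]
  · simp
  · intro U _ hU
    exact Set.indicator_of_notMem (fun h => hU (Eq.symm h)) _
  · simp

theorem intervalIntegrable_comp_sublevel (R : Ω → ℝ) (Φ : Finset Ω → E) (a b : ℝ) :
    IntervalIntegrable (fun x => Φ (sublevel R x)) MeasureTheory.volume a b := by
  simp_rw [comp_sublevel_eq_sum R Φ]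
  have := IntervalIntegrable.sum (μ := MeasureTheory.volume) (a := a) (b := b) Finset.univ
    (f := fun U => Set.indicator {x | sublevel R x = U} (fun _ => Φ U)) (fun U _ => by
      have h : IntervalIntegrable (fun _ : ℝ => Φ U) MeasureTheory.volume a b :=
        intervalIntegrable_const
      exact ⟨h.1.indicator (measurableSet_sublevel_eq R U),
        h.2.indicator (measurableSet_sublevel_eq R U)⟩)
  have he : (fun x => ∑ U : Finset Ω, Set.indicator {x | sublevel R x = U} (fun _ => Φ U) x) =
      ∑ U : Finset Ω, Set.indicator {x | sublevel R x = U} (fun _ => Φ U) := by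
    ext x
    simp
  rwa [he]

/-- The integrand is a step function of the level. The weights do not depend on `Φ`, so the risk,
its gradient and its estimator all share them. -/
theorem integral_comp_sublevel [NormedSpace ℝ E] [CompleteSpace E] (R : Ω → ℝ)
    (Φ : Finset Ω → E) {a b : ℝ} (hab : a ≤ b) :
    ∫ x in a..b, Φ (sublevel R x) = ∑ U : Finset Ω, sublevelWeight R a b U • Φ U := by
  simp_rw [comp_sublevel_eq_sum R Φ]
  rw [intervalIntegral.integral_of_le hab, MeasureTheory.integral_finsetSum]
  · refine Finset.sum_congr rfl fun U _ => ?_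
    rw [MeasureTheory.setIntegral_indicator (measurableSet_sublevel_eq R U),
      MeasureTheory.setIntegral_const]
    rfl
  · intro U _
    have h : IntervalIntegrable (fun _ : ℝ => Φ U) MeasureTheory.volume a b :=
      intervalIntegrable_const
    exact h.1.indicator (measurableSet_sublevel_eq R U)

theorem sum_sublevelWeight (R : Ω → ℝ) {a b : ℝ} (hab : a ≤ b) :
    ∑ U : Finset Ω, sublevelWeight R a b U = b - a := by
  simpa using (integral_comp_sublevel R (fun _ => (1 : ℝ)) hab).symm

end SublevelWeight

/-! ### The derivative of the distortion function up to the endpoint 0. -/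

section Distortion

variable {g : ℝ → ℝ} {B₁ B₂ : ℝ}

theorem distDeriv_eq_deriv {t : ℝ} (ht : t ∈ Set.Ioo (0 : ℝ) 1) : distDeriv g t = deriv g t :=
  derivWithin_of_mem_nhds (Icc_mem_nhds ht.1 ht.2)

theorem abs_deriv_sub_deriv_le (hg₂ : ∀ t ∈ Set.Ioo (0 : ℝ) 1, DifferentiableAt ℝ (deriv g) t)
    (hB₂ : ∀ t ∈ Set.Ioo (0 : ℝ) 1, |deriv (deriv g) t| ≤ B₂) {s t : ℝ}
    (hs : s ∈ Set.Ioo (0 : ℝ) 1) (ht : t ∈ Set.Ioo (0 : ℝ) 1) :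
    |deriv g s - deriv g t| ≤ B₂ * |s - t| := by
  simpa using (convex_Ioo (0 : ℝ) 1).norm_image_sub_le_of_norm_deriv_le hg₂ hB₂ ht hs

/-- A bound on `|g' - c|` over `(0, t)` passes to the one-sided derivative at `0`. -/
theorem abs_distDeriv_zero_sub_le (hg₀ : DifferentiableWithinAt ℝ g (Set.Icc 0 1) 0)
    (hg₁ : ∀ t ∈ Set.Ioo (0 : ℝ) 1, DifferentiableAt ℝ g t) {t c B : ℝ}
    (ht : t ∈ Set.Ioo (0 : ℝ) 1) (hB : ∀ s ∈ Set.Ioo 0 t, |deriv g s - c| ≤ B) :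
    |distDeriv g 0 - c| ≤ B := by
  have h0 : HasDerivWithinAt g (distDeriv g 0) (Set.Ioo 0 t) 0 :=
    hg₀.hasDerivWithinAt.mono fun s hs => ⟨hs.1.le, (hs.2.trans ht.2).le⟩
  rw [hasDerivWithinAt_iff_tendsto_slope' (by simp)] at h0
  have : (nhdsWithin (0 : ℝ) (Set.Ioo 0 t)).NeBot := by
    rw [nhdsWithin_Ioo_eq_nhdsGT ht.1]; infer_instance
  refine le_of_tendsto (h0.sub_const c).abs ?_
  filter_upwards [self_mem_nhdsWithin] with h hh
  -- By the mean value theorem each difference quotient at `0` is a value of `deriv g` inside `(0,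
  -- t)`, and the closed bound survives the limit.
  have hcont : ContinuousOn g (Set.Icc 0 h) := by
    intro s hs
    rcases hs.1.eq_or_lt with rfl | hs0
    · exact hg₀.continuousWithinAt.mono
        (Set.Icc_subset_Icc_right (hh.2.trans ht.2).le)
    · exact (hg₁ s ⟨hs0, hs.2.trans_lt (hh.2.trans ht.2)⟩).continuousAt.continuousWithinAt
  obtain ⟨ξ, hξ, he⟩ := exists_deriv_eq_slope g hh.1 hcont fun s hs =>
    (hg₁ s ⟨hs.1, hs.2.trans (hh.2.trans ht.2)⟩).differentiableWithinAt
  rw [slope_def_field, ← he]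
  exact hB ξ ⟨hξ.1, hξ.2.trans hh.2⟩

/-- The point `0` is needed because an empirical CDF can equal 1. The point `1` is left out: nothing
is assumed about `g'` there. -/
theorem abs_distDeriv_le (hg₀ : DifferentiableWithinAt ℝ g (Set.Icc 0 1) 0)
    (hg₁ : ∀ t ∈ Set.Ioo (0 : ℝ) 1, DifferentiableAt ℝ g t)
    (hB₁ : ∀ t ∈ Set.Ioo (0 : ℝ) 1, |deriv g t| ≤ B₁) {t : ℝ} (ht : t ∈ Set.Ico (0 : ℝ) 1) :
    |distDeriv g t| ≤ B₁ := by
  rcases ht.1.eq_or_lt with rfl | h0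
  · have := abs_distDeriv_zero_sub_le (t := 1 / 2) (c := 0) (B := B₁) hg₀ hg₁ (by norm_num)
      fun s hs => by simpa using hB₁ s ⟨hs.1, hs.2.trans (by norm_num)⟩
    simpa using this
  · rw [distDeriv_eq_deriv ⟨h0, ht.2⟩]
    exact hB₁ t ⟨h0, ht.2⟩

theorem abs_distDeriv_sub_le (hg₀ : DifferentiableWithinAt ℝ g (Set.Icc 0 1) 0)
    (hg₁ : ∀ t ∈ Set.Ioo (0 : ℝ) 1, DifferentiableAt ℝ g t)
    (hg₂ : ∀ t ∈ Set.Ioo (0 : ℝ) 1, DifferentiableAt ℝ (deriv g) t)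
    (hB : 0 ≤ B₂) (hB₂ : ∀ t ∈ Set.Ioo (0 : ℝ) 1, |deriv (deriv g) t| ≤ B₂) {s t : ℝ}
    (hs : s ∈ Set.Ico (0 : ℝ) 1) (ht : t ∈ Set.Ico (0 : ℝ) 1) :
    |distDeriv g s - distDeriv g t| ≤ B₂ * |s - t| := by
  -- On `(0, u)` the derivative stays within `B₂ * u` of its value at `u`; pass to the limit at `0`.
  have key : ∀ u ∈ Set.Ioo (0 : ℝ) 1, |distDeriv g 0 - distDeriv g u| ≤ B₂ * u := by
    intro u hu
    refine abs_distDeriv_zero_sub_le hg₀ hg₁ hu fun r hr => ?_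
    rw [distDeriv_eq_deriv hu]
    refine (abs_deriv_sub_deriv_le hg₂ hB₂ ⟨hr.1, hr.2.trans hu.2⟩ hu).trans ?_
    refine mul_le_mul_of_nonneg_left ?_ hB
    rw [abs_sub_comm, abs_of_pos (sub_pos.2 hr.2)]
    linarith [hr.1]
  rcases hs.1.eq_or_lt with rfl | hs0 <;> rcases ht.1.eq_or_lt with rfl | ht0
  · simp
  · simpa [abs_of_pos ht0] using key t ⟨ht0, ht.2⟩
  · rw [abs_sub_comm]; simpa [abs_of_pos hs0] using key s ⟨hs0, hs.2⟩
  · rw [distDeriv_eq_deriv ⟨hs0, hs.2⟩, distDeriv_eq_deriv ⟨ht0, ht.2⟩]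
    exact abs_deriv_sub_deriv_le hg₂ hB₂ ⟨hs0, hs.2⟩ ⟨ht0, ht.2⟩

theorem IsDistortion.mem_Icc (hg : IsDistortion g) {t : ℝ} (ht : t ∈ Set.Icc (0 : ℝ) 1) :
    g t ∈ Set.Icc (0 : ℝ) 1 :=
  ⟨hg.zero ▸ hg.mono (by simp) ht ht.1, hg.one ▸ hg.mono ht (by simp) ht.2⟩

end Distortion

/-! ### The ascent inequality for a Lipschitz gradient. -/

section Descent

variable {E : Type*} [NormedAddCommGroup E] [InnerProductSpace ℝ E] [CompleteSpace E]

open scoped InnerProductSpace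

/-- The quadratic lower bound for a function whose gradient is Lipschitz. -/
theorem le_of_lipschitz_gradient {f : E → ℝ} {f' : E → E} {K : ℝ}
    (hf : ∀ x, HasGradientAt f (f' x) x) (hK : ∀ x y, ‖f' x - f' y‖ ≤ K * ‖x - y‖) (x v : E) :
    f x + ⟪f' x, v⟫_ℝ - K / 2 * ‖v‖ ^ 2 ≤ f (x + v) := by
  -- The quadratic term makes the derivative of `φ` nonnegative for `t ≥ 0`; comparing `φ 0` with `φ
  -- 1` is the claim.
  let φ : ℝ → ℝ := fun t => f (x + t • v) - t * ⟪f' x, v⟫_ℝ + K / 2 * ‖v‖ ^ 2 * t ^ 2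
  have hφ : ∀ t, HasDerivAt φ (⟪f' (x + t • v), v⟫_ℝ - ⟪f' x, v⟫_ℝ + K * ‖v‖ ^ 2 * t) t := by
    intro t
    have h1 : HasDerivAt (fun t : ℝ => x + t • v) v t := by
      simpa using ((hasDerivAt_id t).smul_const v).const_add x
    have h2 := (hf (x + t • v)).hasFDerivAt.comp_hasDerivAt t h1
    have h3 := (h2.sub ((hasDerivAt_id t).mul_const ⟪f' x, v⟫_ℝ)).add
      ((hasDerivAt_pow 2 t).const_mul (K / 2 * ‖v‖ ^ 2))
    refine HasDerivAt.congr_deriv (f := φ) h3 ?_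
    simp
    ring
  have hmono : MonotoneOn φ (Set.Ici 0) := by
    refine monotoneOn_of_deriv_nonneg (convex_Ici 0)
      (fun t _ => (hφ t).continuousAt.continuousWithinAt)
      (fun t _ => (hφ t).differentiableAt.differentiableWithinAt) fun t ht => ?_
    rw [interior_Ici] at ht
    rw [(hφ t).deriv, ← inner_sub_left]
    have h1 := abs_le.1 (abs_real_inner_le_norm (f' (x + t • v) - f' x) v)
    have h2 := hK (x + t • v) x
    rw [add_sub_cancel_left, norm_smul, Real.norm_of_nonneg (le_of_lt ht)] at h2
    nlinarith [mul_le_mul_of_nonneg_right h2 (norm_nonneg v), h1.1]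
  have := hmono (Set.mem_Ici.2 le_rfl) (Set.mem_Ici.2 zero_le_one) zero_le_one
  simp only [φ] at this
  simp at this
  linarith

end Descent

/-! ### Finite i.i.d. expectations and the variance of a sample mean. -/

section IIDExpectation

variable {Ω : Type*} [Fintype Ω]

/-- The expectation of `f` over `m` independent draws from the weights `p`. -/
def iidExpectation (p : Ω → ℝ) (m : ℕ) (f : (Fin m → Ω) → ℝ) : ℝ :=
  ∑ v, (∏ i, p (v i)) * f v

theorem iidExpectation_succ (p : Ω → ℝ) (m : ℕ) (f : (Fin (m + 1) → Ω) → ℝ) :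
    iidExpectation p (m + 1) f =
      ∑ a, p a * iidExpectation p m fun v => f (Fin.cons a v) := by
  unfold iidExpectation
  rw [← (Fin.consEquiv fun _ : Fin (m + 1) => Ω).sum_comp, Fintype.sum_prod_type]
  simp only [Fin.consEquiv_apply, Fin.prod_univ_succ, Finset.mul_sum, mul_assoc, Fin.cons_zero,
    Fin.cons_succ]
  rfl

theorem iidExpectation_add (p : Ω → ℝ) (m : ℕ) (f h : (Fin m → Ω) → ℝ) :
    iidExpectation p m (fun v => f v + h v) = iidExpectation p m f + iidExpectation p m h := by
  simp [iidExpectation, mul_add, Finset.sum_add_distrib]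

theorem iidExpectation_const_mul (p : Ω → ℝ) (m : ℕ) (c : ℝ) (f : (Fin m → Ω) → ℝ) :
    iidExpectation p m (fun v => c * f v) = c * iidExpectation p m f := by
  simp [iidExpectation, Finset.mul_sum, mul_left_comm]

theorem iidExpectation_sum {ι : Type*} (s : Finset ι) (p : Ω → ℝ) (m : ℕ)
    (f : ι → (Fin m → Ω) → ℝ) :
    iidExpectation p m (fun v => ∑ j ∈ s, f j v) = ∑ j ∈ s, iidExpectation p m (f j) := by
  simp only [iidExpectation, Finset.mul_sum]
  exact Finset.sum_comm

theorem iidExpectation_const {p : Ω → ℝ} (hp : ∑ a, p a = 1) (m : ℕ) (c : ℝ) :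
    iidExpectation p m (fun _ => c) = c := by
  induction m with
  | zero => simp [iidExpectation]
  | succ m ih => rw [iidExpectation_succ]; simp [ih, ← Finset.sum_mul, hp]

theorem iidExpectation_mono {p : Ω → ℝ} (hp : ∀ a, 0 ≤ p a) {m : ℕ} {f h : (Fin m → Ω) → ℝ}
    (hfh : ∀ v, f v ≤ h v) : iidExpectation p m f ≤ iidExpectation p m h :=
  Finset.sum_le_sum fun v _ =>
    mul_le_mul_of_nonneg_left (hfh v) (Finset.prod_nonneg fun i _ => hp (v i))

variable {E : Type*} [NormedAddCommGroup E] [InnerProductSpace ℝ E]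

open scoped InnerProductSpace

/-- Independent centred vectors are orthogonal in mean: splitting off the first draw, the cross term
with the rest vanishes. -/
theorem iidExpectation_norm_sum_sq {p : Ω → ℝ} (hp : ∑ a, p a = 1) (Y : Ω → E)
    (hY : ∑ a, p a • Y a = 0) (m : ℕ) :
    iidExpectation p m (fun v => ‖∑ i, Y (v i)‖ ^ 2) = m * ∑ a, p a * ‖Y a‖ ^ 2 := by
  induction m with
  | zero => simp [iidExpectation]
  | succ m ih =>
    have hcross : ∑ a, p a * iidExpectation p m (fun v => 2 * ⟪Y a, ∑ i, Y (v i)⟫_ℝ) = 0 := by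
      have : ∀ v : Fin m → Ω, ∑ a, p a * ⟪Y a, ∑ i, Y (v i)⟫_ℝ = 0 := by
        intro v
        simp_rw [← real_inner_smul_left]
        rw [← sum_inner, hY, inner_zero_left]
      calc _ = iidExpectation p m (fun v => 2 * ∑ a, p a * ⟪Y a, ∑ i, Y (v i)⟫_ℝ) := by
            simp_rw [iidExpectation_const_mul, iidExpectation_sum, iidExpectation_const_mul,
              Finset.mul_sum]
            exact Finset.sum_congr rfl fun a _ => by ring
        _ = 0 := by simp [this, iidExpectation]
    rw [iidExpectation_succ]
    simp_rw [Fin.sum_univ_succ, Fin.cons_zero, Fin.cons_succ, norm_add_sq_real,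
      iidExpectation_add, mul_add, Finset.sum_add_distrib]
    rw [hcross, ih]
    simp_rw [iidExpectation_const hp]
    rw [← Finset.sum_mul, hp]
    push_cast
    ring

/-- The mean of `m` independent draws of a vector bounded by `K` has variance at most `K² / m`. -/
theorem iidExpectation_norm_mean_sub_sq_le {p : Ω → ℝ} (hp₀ : ∀ a, 0 ≤ p a)
    (hp : ∑ a, p a = 1) (X : Ω → E) {K : ℝ} (hX : ∀ a, ‖X a‖ ≤ K) {m : ℕ} (hm : 1 ≤ m) :
    iidExpectation p m (fun v => ‖(m : ℝ)⁻¹ • ∑ i, X (v i) - ∑ a, p a • X a‖ ^ 2) ≤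
      K ^ 2 / m := by
  set μ : E := ∑ a, p a • X a with hμ
  have hm' : (0 : ℝ) < m := by exact_mod_cast hm
  have hY : ∑ a, p a • (X a - μ) = 0 := by
    simp_rw [smul_sub, Finset.sum_sub_distrib, ← Finset.sum_smul, hp, one_smul]
    exact sub_self _
  -- The variance is the second moment minus `‖μ‖ ^ 2`, so centring costs no factor.
  have hvar : ∑ a, p a * ‖X a - μ‖ ^ 2 ≤ K ^ 2 := by
    have h1 : ∑ a, p a * ‖X a - μ‖ ^ 2 = ∑ a, p a * ‖X a‖ ^ 2 - ‖μ‖ ^ 2 := by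
      have h2 : ∑ a, p a * ⟪X a, μ⟫_ℝ = ‖μ‖ ^ 2 := by
        simp_rw [← real_inner_smul_left]
        rw [← sum_inner, ← hμ, real_inner_self_eq_norm_sq]
      simp_rw [norm_sub_sq_real, mul_add, mul_sub, Finset.sum_add_distrib,
        Finset.sum_sub_distrib, ← Finset.sum_mul, hp, mul_left_comm _ (2 : ℝ), ← Finset.mul_sum, h2]
      ring
    have h3 : ∑ a, p a * ‖X a‖ ^ 2 ≤ ∑ a, p a * K ^ 2 := Finset.sum_le_sum fun a _ =>
      mul_le_mul_of_nonneg_left (pow_le_pow_left₀ (norm_nonneg _) (hX a) 2) (hp₀ a)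
    rw [← Finset.sum_mul, hp, one_mul] at h3
    nlinarith [sq_nonneg ‖μ‖]
  have he : ∀ v : Fin m → Ω, ‖(m : ℝ)⁻¹ • ∑ i, X (v i) - μ‖ ^ 2 =
      ((m : ℝ)⁻¹) ^ 2 * ‖∑ i, (X (v i) - μ)‖ ^ 2 := by
    intro v
    rw [← mul_pow]
    congr 1
    rw [← abs_of_pos (inv_pos.2 hm'), ← Real.norm_eq_abs, ← norm_smul, Real.norm_eq_abs,
      abs_of_pos (inv_pos.2 hm'), Finset.sum_sub_distrib, smul_sub]
    congr 2
    simp [← Nat.cast_smul_eq_nsmul ℝ, smul_smul, hm'.ne']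
  simp_rw [he]
  rw [iidExpectation_const_mul, iidExpectation_norm_sum_sq hp _ hY]
  calc _ = (∑ a, p a * ‖X a - μ‖ ^ 2) / m := by field_simp
    _ ≤ _ := by gcongr

open Classical in
/-- Expectations under `iidLaw` are finite sums when the marginal law has finite support. -/
theorem tsum_iidLaw_mul {α : Type*} (q : PMF α) (s : Set α) [Fintype s] (hs : q.support ⊆ s)
    (m : ℕ) (F : (Fin m → α) → ℝ) (hF : ∀ w, 0 ≤ F w) :
    ∑' w, iidLaw q m w * ENNReal.ofReal (F w) =
      ENNReal.ofReal (iidExpectation (fun a : s => (q a).toReal) m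
        fun v => F fun i => v i) := by
  have hinj : Function.Injective fun (v : Fin m → s) (i : Fin m) => (v i : α) := by
    intro v v' h
    funext i
    exact Subtype.ext (congrFun h i)
  have hval : ∀ w, iidLaw q m w = ∏ i, q (w i) := fun w => rfl
  rw [← hinj.tsum_eq, tsum_fintype, iidExpectation, ENNReal.ofReal_sum_of_nonneg]
  · refine Finset.sum_congr rfl fun v _ => ?_
    rw [ENNReal.ofReal_mul (Finset.prod_nonneg fun i _ => ENNReal.toReal_nonneg),
      ENNReal.ofReal_prod_of_nonneg fun i _ => ENNReal.toReal_nonneg, hval]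
    simp [ENNReal.ofReal_toReal (q.apply_ne_top _)]
  · exact fun v _ => mul_nonneg (Finset.prod_nonneg fun i _ => ENNReal.toReal_nonneg) (hF _)
  -- A batch of nonzero probability has every coordinate in the support of `q`, hence in `s`.
  · intro w hw
    have hw' : ∀ i, w i ∈ s := fun i => hs <| by
      rw [Function.mem_support, hval] at hw
      exact (Finset.prod_ne_zero_iff.1 (left_ne_zero_of_mul hw)) i (Finset.mem_univ i)
    exact ⟨fun i => ⟨w i, hw' i⟩, rfl⟩

end IIDExpectation

/-! ### Likelihood models and gradients of event probabilities. -/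

/-- A parametrized family of positive probability weights on a finite set whose log-likelihoods
are twice differentiable, with gradient (the score) bounded by `K₁` and Hessian by `K₂`. -/
structure LikelihoodModel (E Ω : Type*) [NormedAddCommGroup E] [InnerProductSpace ℝ E]
    [CompleteSpace E] [Fintype Ω] (K₁ K₂ : ℝ) where
  prob : E → Ω → ℝ
  score : Ω → E → E
  prob_pos : ∀ θ ω, 0 < prob θ ω
  sum_prob : ∀ θ, ∑ ω, prob θ ω = 1
  hasGradientAt : ∀ θ ω, HasGradientAt (fun θ => prob θ ω) (prob θ ω • score ω θ) θ
  differentiable_score : ∀ ω, Differentiable ℝ (score ω)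
  norm_score_le : ∀ ω θ, ‖score ω θ‖ ≤ K₁
  norm_fderiv_score_le : ∀ ω θ, ‖fderiv ℝ (score ω) θ‖ ≤ K₂

namespace LikelihoodModel

variable {E Ω : Type*} [NormedAddCommGroup E] [InnerProductSpace ℝ E] [CompleteSpace E]
  [Fintype Ω] {K₁ K₂ : ℝ} (P : LikelihoodModel E Ω K₁ K₂)

open scoped InnerProductSpace

/-- The probability of the event `U`. -/
def eventProb (U : Finset Ω) (θ : E) : ℝ := ∑ ω ∈ U, P.prob θ ω

/-- The gradient of the probability of the event `U`, in likelihood-ratio form. -/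
def eventGrad (U : Finset Ω) (θ : E) : E := ∑ ω ∈ U, P.prob θ ω • P.score ω θ

theorem eventProb_univ (θ : E) : P.eventProb Finset.univ θ = 1 := P.sum_prob θ

theorem eventProb_nonneg (U : Finset Ω) (θ : E) : 0 ≤ P.eventProb U θ :=
  Finset.sum_nonneg fun ω _ => (P.prob_pos θ ω).le

theorem eventProb_le_one (U : Finset Ω) (θ : E) : P.eventProb U θ ≤ 1 :=
  P.sum_prob θ ▸ Finset.sum_le_sum_of_subset_of_nonneg (Finset.subset_univ U)
    fun ω _ _ => (P.prob_pos θ ω).le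

theorem eventProb_pos {U : Finset Ω} (hU : U.Nonempty) (θ : E) : 0 < P.eventProb U θ :=
  Finset.sum_pos (fun ω _ => P.prob_pos θ ω) hU

/-- With `eventProb_pos`, this keeps nontrivial events inside `(0, 1)`, where `g` is differentiable.
-/
theorem eventProb_lt_one {U : Finset Ω} (hU : U ≠ Finset.univ) (θ : E) :
    P.eventProb U θ < 1 := by
  obtain ⟨ω, hω⟩ : ∃ ω, ω ∉ U := by
    by_contra! h
    exact hU (Finset.eq_univ_iff_forall.2 h)
  exact P.sum_prob θ ▸ Finset.sum_lt_sum_of_subset (Finset.subset_univ U) (Finset.mem_univ ω) hω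
    (P.prob_pos θ ω) fun ω _ _ => (P.prob_pos θ ω).le

theorem hasGradientAt_eventProb (U : Finset Ω) (θ : E) :
    HasGradientAt (P.eventProb U) (P.eventGrad U θ) θ := by
  rw [hasGradientAt_iff_hasFDerivAt]
  have := HasFDerivAt.fun_sum (u := U) fun ω _ => (P.hasGradientAt θ ω).hasFDerivAt
  rw [eventGrad, map_sum]
  exact this

/-- The score has mean zero, since total probability is constant. -/
theorem eventGrad_univ (θ : E) : P.eventGrad Finset.univ θ = 0 := by
  have h : P.eventProb Finset.univ = fun _ => 1 := funext P.eventProb_univ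
  exact (P.hasGradientAt_eventProb Finset.univ θ).unique (h ▸ hasGradientAt_const θ 1)

theorem sum_smul_le_of_norm_le {F : Type*} [SeminormedAddCommGroup F] [NormedSpace ℝ F] {K : ℝ}
    (hK : 0 ≤ K) (U : Finset Ω) (θ : E) (X : Ω → F) (hX : ∀ ω, ‖X ω‖ ≤ K) :
    ‖∑ ω ∈ U, P.prob θ ω • X ω‖ ≤ K := by
  calc _ ≤ ∑ ω ∈ U, P.prob θ ω * K := norm_sum_le_of_le _ fun ω _ => by
        rw [norm_smul, Real.norm_of_nonneg (P.prob_pos θ ω).le]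
        exact mul_le_mul_of_nonneg_left (hX ω) (P.prob_pos θ ω).le
    _ = P.eventProb U θ * K := by rw [← Finset.sum_mul]; rfl
    _ ≤ K := mul_le_of_le_one_left hK (P.eventProb_le_one U θ)

theorem norm_eventGrad_le (hK₁ : 0 ≤ K₁) (U : Finset Ω) (θ : E) : ‖P.eventGrad U θ‖ ≤ K₁ :=
  P.sum_smul_le_of_norm_le hK₁ U θ _ fun ω => P.norm_score_le ω θ

theorem abs_eventProb_sub_le (hK₁ : 0 ≤ K₁) (U : Finset Ω) (θ η : E) :
    |P.eventProb U θ - P.eventProb U η| ≤ K₁ * ‖θ - η‖ := by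
  refine convex_univ.norm_image_sub_le_of_norm_hasFDerivWithin_le
    (fun x _ => (P.hasGradientAt_eventProb U x).hasFDerivAt.hasFDerivWithinAt) (fun x _ => ?_)
    (Set.mem_univ η) (Set.mem_univ θ)
  rw [LinearIsometryEquiv.norm_map]
  exact P.norm_eventGrad_le hK₁ U x

/-- Differentiating `prob • score` gives `prob` times the Hessian plus the score tensored with
itself; these have norms at most `K₂` and `K₁ ^ 2`. -/
theorem norm_eventGrad_sub_le (hK₂ : 0 ≤ K₂) (U : Finset Ω) (θ η : E) :
    ‖P.eventGrad U θ - P.eventGrad U η‖ ≤ (K₂ + K₁ ^ 2) * ‖θ - η‖ := by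
  let H : E → Ω → E →L[ℝ] E := fun x ω =>
    fderiv ℝ (P.score ω) x + (InnerProductSpace.toDual ℝ E (P.score ω x)).smulRight (P.score ω x)
  have hH : ∀ x, HasFDerivAt (P.eventGrad U) (∑ ω ∈ U, P.prob x ω • H x ω) x := by
    intro x
    refine HasFDerivAt.fun_sum fun ω _ => ?_
    refine ((P.hasGradientAt x ω).hasFDerivAt.fun_smul
      (P.differentiable_score ω x).hasFDerivAt).congr_fderiv ?_
    ext v
    simp [H, smul_smul]
  refine convex_univ.norm_image_sub_le_of_norm_hasFDerivWithin_le
    (fun x _ => (hH x).hasFDerivWithinAt) (fun x _ => ?_) (Set.mem_univ η) (Set.mem_univ θ)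
  refine P.sum_smul_le_of_norm_le (by positivity) U x _ fun ω => ?_
  refine (norm_add_le _ _).trans (add_le_add (P.norm_fderiv_score_le ω x) ?_)
  rw [ContinuousLinearMap.norm_smulRight_apply, LinearIsometryEquiv.norm_map, ← sq]
  exact pow_le_pow_left₀ (norm_nonneg _) (P.norm_score_le ω x) 2

end LikelihoodModel

/-! ### Perturbation bounds for the integrand of the gradient. -/

/-- A distortion function that is differentiable on `(0, 1)` and whose derivative, extended by the
right derivative at `0`, is bounded by `B₁` and `B₂`-Lipschitz on `[0, 1)`. -/
structure IsSmoothDistortion (g : ℝ → ℝ) (B₁ B₂ : ℝ) : Prop extends IsDistortion g where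
  hasDerivAt : ∀ t ∈ Set.Ioo (0 : ℝ) 1, HasDerivAt g (distDeriv g t) t
  abs_deriv_le : ∀ t ∈ Set.Ico (0 : ℝ) 1, |distDeriv g t| ≤ B₁
  abs_deriv_sub_le : ∀ s ∈ Set.Ico (0 : ℝ) 1, ∀ t ∈ Set.Ico (0 : ℝ) 1,
    |distDeriv g s - distDeriv g t| ≤ B₂ * |s - t|
  bound_nonneg : 0 ≤ B₁
  lipschitz_nonneg : 0 ≤ B₂

namespace IsSmoothDistortion

variable {g : ℝ → ℝ} {B₁ B₂ : ℝ} (hg : IsSmoothDistortion g B₁ B₂)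
variable {E : Type*} [NormedAddCommGroup E] [NormedSpace ℝ E]

include hg

/-- At `p = 0` the uncontrolled value of `distDeriv g` at `1` appears; the hypothesis `hD`
annihilates it. -/
theorem norm_deriv_smul_le {p : ℝ} (hp : p ∈ Set.Icc (0 : ℝ) 1) {D : E} (hD : p = 0 → D = 0) :
    ‖distDeriv g (1 - p) • D‖ ≤ B₁ * ‖D‖ := by
  rcases hp.1.eq_or_lt with h | h
  · simp [hD h.symm]
  · rw [norm_smul]
    exact mul_le_mul_of_nonneg_right
      (hg.abs_deriv_le _ ⟨by linarith [hp.2], by linarith⟩) (norm_nonneg D)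

/-- A product-rule splitting, used both for two parameters (smoothness) and for empirical against
true values (estimation error). If `p` or `q` is `0`, one product vanishes and the `B₁` term alone
suffices. -/
theorem norm_deriv_smul_sub_le {p q : ℝ} (hp : p ∈ Set.Icc (0 : ℝ) 1)
    (hq : q ∈ Set.Icc (0 : ℝ) 1) {D D' : E} (hD : p = 0 → D = 0) (hD' : q = 0 → D' = 0) :
    ‖distDeriv g (1 - p) • D - distDeriv g (1 - q) • D'‖ ≤
      B₁ * ‖D - D'‖ + B₂ * |p - q| * ‖D'‖ := by
  have hnn : 0 ≤ B₂ * |p - q| * ‖D'‖ :=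
    mul_nonneg (mul_nonneg hg.lipschitz_nonneg (abs_nonneg _)) (norm_nonneg _)
  rcases hq.1.eq_or_lt with h | h
  · have := hg.norm_deriv_smul_le hp hD
    rw [hD' h.symm] at hnn ⊢
    simp only [smul_zero, sub_zero]
    linarith
  rcases hp.1.eq_or_lt with h' | h'
  · have := hg.norm_deriv_smul_le hq hD'
    rw [hD h'.symm]
    simp only [smul_zero, zero_sub, norm_neg]
    linarith
  have he : distDeriv g (1 - p) • D - distDeriv g (1 - q) • D' =
      distDeriv g (1 - p) • (D - D') + (distDeriv g (1 - p) - distDeriv g (1 - q)) • D' := by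
    rw [smul_sub, sub_smul]; abel
  rw [he]
  refine (norm_add_le _ _).trans ?_
  rw [norm_smul, norm_smul]
  have h1 := hg.abs_deriv_le (1 - p) ⟨by linarith [hp.2], by linarith⟩
  have h2 := hg.abs_deriv_sub_le (1 - p) ⟨by linarith [hp.2], by linarith⟩ (1 - q)
    ⟨by linarith [hq.2], by linarith⟩
  rw [sub_sub_sub_cancel_left, abs_sub_comm q p] at h2
  gcongr <;> assumption

end IsSmoothDistortion

/-- Triangle inequality, then weighted Cauchy–Schwarz. -/
theorem sq_norm_sum_smul_le {ι E : Type*} [Fintype ι] [SeminormedAddCommGroup E] [NormedSpace ℝ E]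
    {w : ι → ℝ} (hw : ∀ i, 0 ≤ w i) (x : ι → E) :
    ‖∑ i, w i • x i‖ ^ 2 ≤ (∑ i, w i) * ∑ i, w i * ‖x i‖ ^ 2 := by
  have h1 : ‖∑ i, w i • x i‖ ≤ ∑ i, w i * ‖x i‖ := norm_sum_le_of_le _ fun i _ => by
    rw [norm_smul, Real.norm_of_nonneg (hw i)]
  refine (pow_le_pow_left₀ (norm_nonneg _) h1 2).trans ?_
  exact Finset.sum_sq_le_sum_mul_sum_of_sq_le_mul _ (fun i _ => hw i)
    (fun i _ => mul_nonneg (hw i) (sq_nonneg _)) fun i _ => by rw [mul_pow, sq, mul_assoc]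

/-! ### The risk functional, its gradient and its plug-in estimator. -/

namespace LikelihoodModel

variable {E Ω : Type*} [NormedAddCommGroup E] [InnerProductSpace ℝ E] [CompleteSpace E]
  [Fintype Ω] {K₁ K₂ : ℝ} (P : LikelihoodModel E Ω K₁ K₂) (g : ℝ → ℝ) {B₁ B₂ : ℝ}
  (w : Finset Ω → ℝ)

open scoped InnerProductSpace

theorem eventProb_mem_Icc (U : Finset Ω) (θ : E) : P.eventProb U θ ∈ Set.Icc (0 : ℝ) 1 :=
  ⟨P.eventProb_nonneg U θ, P.eventProb_le_one U θ⟩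

theorem eventGrad_eq_zero {U : Finset Ω} {θ : E} (h : P.eventProb U θ = 0) :
    P.eventGrad U θ = 0 := by
  rcases U.eq_empty_or_nonempty with rfl | hU
  · simp [eventGrad]
  · exact absurd h (P.eventProb_pos hU θ).ne'

/-- The chain rule applies only to nontrivial events; for the empty and full events the function is
constant, so no differentiability of `g` at the endpoints is used. -/
theorem hasGradientAt_distortion {g : ℝ → ℝ} (hg : IsSmoothDistortion g B₁ B₂) (U : Finset Ω)
    (θ : E) : HasGradientAt (fun θ => g (1 - P.eventProb U θ))
      (-(distDeriv g (1 - P.eventProb U θ) • P.eventGrad U θ)) θ := by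
  rcases U.eq_empty_or_nonempty with rfl | hU
  · simpa [eventGrad, eventProb] using hasGradientAt_const θ (g 1)
  by_cases hU' : U = Finset.univ
  · subst hU'
    simp only [eventProb_univ, eventGrad_univ, smul_zero, neg_zero]
    exact hasGradientAt_const θ _
  have h := (hg.hasDerivAt (1 - P.eventProb U θ) ⟨by linarith [P.eventProb_lt_one hU' θ],
    by linarith [P.eventProb_pos hU θ]⟩).comp_hasFDerivAt θ
      ((P.hasGradientAt_eventProb U θ).hasFDerivAt.const_sub 1)
  rw [hasGradientAt_iff_hasFDerivAt]
  refine h.congr_fderiv ?_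
  ext v
  simp

/-- A weighted sum of distorted event probabilities. -/
noncomputable def risk (θ : E) : ℝ := ∑ U, w U * g (1 - P.eventProb U θ)

/-- The gradient of `risk`. -/
noncomputable def riskGrad (θ : E) : E :=
  -∑ U, w U • distDeriv g (1 - P.eventProb U θ) • P.eventGrad U θ

open Classical in
/-- The empirical probability of the event `U`. -/
noncomputable def empProb {m : ℕ} (v : Fin m → Ω) (U : Finset Ω) : ℝ :=
  (m : ℝ)⁻¹ • ∑ i, if v i ∈ U then 1 else 0

open Classical in
/-- The likelihood-ratio estimate of the gradient of the probability of the event `U`. -/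
noncomputable def empGrad {m : ℕ} (θ : E) (v : Fin m → Ω) (U : Finset Ω) : E :=
  (m : ℝ)⁻¹ • ∑ i, if v i ∈ U then P.score (v i) θ else 0

/-- The plug-in estimate of `riskGrad` from `m` samples. -/
noncomputable def riskGradEstimate {m : ℕ} (θ : E) (v : Fin m → Ω) : E :=
  -∑ U, w U • distDeriv g (1 - empProb v U) • P.empGrad θ v U

variable {g w}

theorem hasGradientAt_risk (hg : IsSmoothDistortion g B₁ B₂) (θ : E) :
    HasGradientAt (P.risk g w) (P.riskGrad g w θ) θ := by
  rw [hasGradientAt_iff_hasFDerivAt]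
  have h := HasFDerivAt.fun_sum (u := Finset.univ) fun (U : Finset Ω) _ =>
    (P.hasGradientAt_distortion hg U θ).hasFDerivAt.const_mul (w U)
  refine h.congr_fderiv ?_
  ext v
  simp [riskGrad]

theorem norm_riskGrad_sub_le (hg : IsSmoothDistortion g B₁ B₂) (hw : ∀ U, 0 ≤ w U)
    (hK₁ : 0 ≤ K₁) (hK₂ : 0 ≤ K₂) (θ η : E) :
    ‖P.riskGrad g w θ - P.riskGrad g w η‖ ≤
      (∑ U, w U) * (B₁ * (K₂ + K₁ ^ 2) + B₂ * K₁ ^ 2) * ‖θ - η‖ := by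
  have hB₁ := hg.bound_nonneg
  have hB₂ := hg.lipschitz_nonneg
  rw [riskGrad, riskGrad, ← norm_neg, neg_sub_neg, neg_sub, ← Finset.sum_sub_distrib, mul_assoc,
    Finset.sum_mul]
  refine norm_sum_le_of_le _ fun U _ => ?_
  rw [← smul_sub, norm_smul, Real.norm_of_nonneg (hw U)]
  refine mul_le_mul_of_nonneg_left ?_ (hw U)
  refine (hg.norm_deriv_smul_sub_le (P.eventProb_mem_Icc U θ) (P.eventProb_mem_Icc U η)
    P.eventGrad_eq_zero P.eventGrad_eq_zero).trans ?_
  calc _ ≤ B₁ * ((K₂ + K₁ ^ 2) * ‖θ - η‖) + B₂ * (K₁ * ‖θ - η‖) * K₁ := by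
        gcongr
        · exact P.norm_eventGrad_sub_le hK₂ U θ η
        · exact P.abs_eventProb_sub_le hK₁ U θ η
        · exact P.norm_eventGrad_le hK₁ U η
    _ = _ := by ring

theorem norm_riskGrad_le (hg : IsSmoothDistortion g B₁ B₂) (hw : ∀ U, 0 ≤ w U)
    (hK₁ : 0 ≤ K₁) (θ : E) : ‖P.riskGrad g w θ‖ ≤ (∑ U, w U) * (B₁ * K₁) := by
  rw [riskGrad, norm_neg, Finset.sum_mul]
  refine norm_sum_le_of_le _ fun U _ => ?_
  rw [norm_smul, Real.norm_of_nonneg (hw U)]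
  refine mul_le_mul_of_nonneg_left ?_ (hw U)
  exact (hg.norm_deriv_smul_le (P.eventProb_mem_Icc U θ) P.eventGrad_eq_zero).trans
    (mul_le_mul_of_nonneg_left (P.norm_eventGrad_le hK₁ U θ) hg.bound_nonneg)

theorem risk_le (hg : IsSmoothDistortion g B₁ B₂) (hw : ∀ U, 0 ≤ w U) (θ : E) :
    P.risk g w θ ≤ ∑ U, w U := by
  refine Finset.sum_le_sum fun U _ => mul_le_of_le_one_right (hw U) ?_
  have := P.eventProb_mem_Icc U θ
  exact (hg.toIsDistortion.mem_Icc ⟨by linarith [this.2], by linarith [this.1]⟩).2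

omit [Fintype Ω] in
open Classical in
theorem empProb_mem_Icc {m : ℕ} (v : Fin m → Ω) (U : Finset Ω) :
    empProb v U ∈ Set.Icc (0 : ℝ) 1 := by
  rw [empProb, smul_eq_mul]
  refine ⟨mul_nonneg (by positivity)
    (Finset.sum_nonneg fun i _ => by split_ifs <;> norm_num), ?_⟩
  refine inv_mul_le_one_of_le₀ ?_ (Nat.cast_nonneg m)
  simpa using Finset.sum_le_card_nsmul (Finset.univ : Finset (Fin m)) (fun i => if v i ∈ U then 1
    else (0 : ℝ)) 1 fun i _ => by split_ifs <;> norm_num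

/-- No sample fell in `U`. This is what lets `norm_deriv_smul_sub_le` accept empirical quantities.
-/
theorem empGrad_eq_zero {m : ℕ} {θ : E} {v : Fin m → Ω} {U : Finset Ω} (h : empProb v U = 0) :
    P.empGrad θ v U = 0 := by
  rw [empProb, smul_eq_zero, Finset.sum_eq_zero_iff_of_nonneg
    fun i _ => by split_ifs <;> norm_num] at h
  rcases h with h | h
  · simp [empGrad, h]
  · rw [empGrad, Finset.sum_eq_zero, smul_zero]
    intro i hi
    have := h i hi
    split_ifs at this ⊢ <;> simp_all

-- A mean of indicators has variance at most `1 / m`. A bound for each fixed event is enough: no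
-- uniform concentration is needed, since the errors are later averaged over events.
open Classical in
theorem iidExpectation_empProb_sub_sq_le (θ : E) {m : ℕ} (hm : 1 ≤ m) (U : Finset Ω) :
    iidExpectation (P.prob θ) m (fun v => |empProb v U - P.eventProb U θ| ^ 2) ≤ 1 / m := by
  have := iidExpectation_norm_mean_sub_sq_le (fun ω => (P.prob_pos θ ω).le) (P.sum_prob θ)
    (fun ω => if ω ∈ U then (1 : ℝ) else 0) (K := 1) (fun ω => by split_ifs <;> simp) hm
  simpa [empProb, eventProb] using this

open Classical in
theorem iidExpectation_empGrad_sub_sq_le (hK₁ : 0 ≤ K₁) (θ : E) {m : ℕ} (hm : 1 ≤ m)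
    (U : Finset Ω) :
    iidExpectation (P.prob θ) m (fun v => ‖P.empGrad θ v U - P.eventGrad U θ‖ ^ 2) ≤
      K₁ ^ 2 / m := by
  have := iidExpectation_norm_mean_sub_sq_le (fun ω => (P.prob_pos θ ω).le) (P.sum_prob θ)
    (fun ω => if ω ∈ U then P.score ω θ else 0) (K := K₁)
    (fun ω => by split_ifs <;> simp [hK₁, P.norm_score_le]) hm
  simpa [empGrad, eventGrad, smul_ite, Finset.sum_ite_mem] using this

/-- The mean square error of the plug-in gradient estimate is of order `1 / m`. -/
theorem iidExpectation_riskGradEstimate_sub_sq_le (hg : IsSmoothDistortion g B₁ B₂)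
    (hw : ∀ U, 0 ≤ w U) (hK₁ : 0 ≤ K₁) (θ : E) {m : ℕ} (hm : 1 ≤ m) :
    iidExpectation (P.prob θ) m
        (fun v => ‖P.riskGradEstimate g w θ v - P.riskGrad g w θ‖ ^ 2) ≤
      (∑ U, w U) ^ 2 * K₁ ^ 2 * (2 * (B₁ ^ 2 + B₂ ^ 2)) / m := by
  set W := ∑ U, w U with hW
  have hW0 : 0 ≤ W := Finset.sum_nonneg fun U _ => hw U
  have hpt : ∀ v : Fin m → Ω, ‖P.riskGradEstimate g w θ v - P.riskGrad g w θ‖ ^ 2 ≤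
      W * ∑ U, w U * (2 * B₁ ^ 2 * ‖P.empGrad θ v U - P.eventGrad U θ‖ ^ 2 +
        2 * B₂ ^ 2 * K₁ ^ 2 * |empProb v U - P.eventProb U θ| ^ 2) := by
    intro v
    rw [riskGradEstimate, riskGrad, ← norm_neg, neg_sub_neg, neg_sub, ← Finset.sum_sub_distrib]
    simp_rw [← smul_sub]
    refine (sq_norm_sum_smul_le hw _).trans ?_
    refine mul_le_mul_of_nonneg_left (Finset.sum_le_sum fun U _ => ?_) hW0
    refine mul_le_mul_of_nonneg_left ?_ (hw U)
    have h1 := hg.norm_deriv_smul_sub_le (empProb_mem_Icc v U) (P.eventProb_mem_Icc U θ)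
      (P.empGrad_eq_zero (θ := θ)) P.eventGrad_eq_zero
    have h2 : B₂ * |empProb v U - P.eventProb U θ| * ‖P.eventGrad U θ‖ ≤
        B₂ * |empProb v U - P.eventProb U θ| * K₁ :=
      mul_le_mul_of_nonneg_left (P.norm_eventGrad_le hK₁ U θ)
        (mul_nonneg hg.lipschitz_nonneg (abs_nonneg _))
    refine (pow_le_pow_left₀ (norm_nonneg _) (h1.trans (add_le_add_right h2 _)) 2).trans ?_
    -- This is `(a + b)² ≤ 2a² + 2b²`.
    nlinarith [sq_nonneg (B₁ * ‖P.empGrad θ v U - P.eventGrad U θ‖ -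
      B₂ * |empProb v U - P.eventProb U θ| * K₁)]
  refine (iidExpectation_mono (fun ω => (P.prob_pos θ ω).le) hpt).trans ?_
  simp_rw [iidExpectation_const_mul, iidExpectation_sum, iidExpectation_const_mul,
    iidExpectation_add, iidExpectation_const_mul]
  calc _ ≤ W * ∑ U, w U * (2 * B₁ ^ 2 * (K₁ ^ 2 / m) + 2 * B₂ ^ 2 * K₁ ^ 2 * (1 / m)) := by
        gcongr with U
        · exact hw U
        · exact P.iidExpectation_empGrad_sub_sq_le hK₁ θ hm U
        · exact P.iidExpectation_empProb_sub_sq_le θ hm U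
    _ = _ := by rw [← Finset.sum_mul, ← hW]; ring

/-- One step of stochastic gradient ascent with `α L ≤ 1`. -/
theorem iidExpectation_gap_step_le (hg : IsSmoothDistortion g B₁ B₂) (hw : ∀ U, 0 ≤ w U)
    (hK₁ : 0 ≤ K₁) (hK₂ : 0 ≤ K₂) {α : ℝ} (hα : 0 ≤ α)
    (hαL : α * ((∑ U, w U) * (B₁ * (K₂ + K₁ ^ 2) + B₂ * K₁ ^ 2)) ≤ 1) (c : ℝ) (θ : E) {m : ℕ}
    (hm : 1 ≤ m) :
    iidExpectation (P.prob θ) m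
        (fun v => c - P.risk g w (θ + α • P.riskGradEstimate g w θ v)) +
        α / 2 * ‖P.riskGrad g w θ‖ ^ 2 ≤
      c - P.risk g w θ +
        α / 2 * ((∑ U, w U) ^ 2 * K₁ ^ 2 * (2 * (B₁ ^ 2 + B₂ ^ 2)) / m) := by
  set L := (∑ U, w U) * (B₁ * (K₂ + K₁ ^ 2) + B₂ * K₁ ^ 2)
  have hpt : ∀ v : Fin m → Ω, c - P.risk g w (θ + α • P.riskGradEstimate g w θ v) ≤
      (c - P.risk g w θ - α / 2 * ‖P.riskGrad g w θ‖ ^ 2) +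
        α / 2 * ‖P.riskGradEstimate g w θ v - P.riskGrad g w θ‖ ^ 2 := by
    intro v
    set h := P.riskGradEstimate g w θ v
    have h1 := le_of_lipschitz_gradient (P.hasGradientAt_risk (w := w) hg)
      (P.norm_riskGrad_sub_le hg hw hK₁ hK₂) θ (α • h)
    rw [real_inner_smul_right, norm_smul, Real.norm_of_nonneg hα] at h1
    have h2 := norm_sub_sq_real h (P.riskGrad g w θ)
    rw [real_inner_comm] at h2
    -- Since `α * L ≤ 1`, the quadratic loss is at most `α / 2 * ‖h‖ ^ 2`; expanding `‖h - ∇‖ ^ 2`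
    -- then absorbs both this loss and the inner product, so unbiasedness of `h` plays no role.
    have h3 : 0 ≤ α * (1 - α * L) * ‖h‖ ^ 2 :=
      mul_nonneg (mul_nonneg hα (by linarith)) (sq_nonneg _)
    have h4 := congrArg (fun x => α / 2 * x) h2
    linarith
  have h := iidExpectation_mono (fun ω => (P.prob_pos θ ω).le) hpt
  rw [iidExpectation_add, iidExpectation_const (P.sum_prob θ), iidExpectation_const_mul] at h
  have h2 := mul_le_mul_of_nonneg_left
    (P.iidExpectation_riskGradEstimate_sub_sq_le hg hw hK₁ θ hm) (by positivity : 0 ≤ α / 2)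
  linarith

end LikelihoodModel

/-! ### Expectations under discrete laws. -/

namespace PMF

variable {α β : Type*}

theorem tsum_bind_mul (p : PMF α) (f : α → PMF β) (F : β → ℝ≥0∞) :
    ∑' b, p.bind f b * F b = ∑' a, p a * ∑' b, f a b * F b := by
  simp_rw [bind_apply, ← ENNReal.tsum_mul_right, ← ENNReal.tsum_mul_left, ← mul_assoc]
  exact ENNReal.tsum_comm

theorem tsum_pure_mul (a : α) (F : α → ℝ≥0∞) : ∑' b, pure a b * F b = F a := by
  rw [tsum_eq_single a fun b hb => by simp [pure_apply_of_ne _ _ hb]]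
  simp

theorem tsum_map_mul (p : PMF α) (f : α → β) (F : β → ℝ≥0∞) :
    ∑' b, p.map f b * F b = ∑' a, p a * F (f a) := by
  rw [map, tsum_bind_mul]
  simp_rw [Function.comp_apply, tsum_pure_mul]

end PMF

/-! ### The common finite support of the episode laws. -/

namespace EpisodicMDP

variable {S A : Type*} (M : EpisodicMDP S A)

-- With `q'` everywhere positive, only the transition law can make a path impossible, and it does
-- not depend on the policy.
open Classical in
theorem episodeProb_ne_zero {q q' : S → PMF A} (hq' : ∀ s a, q' s a ≠ 0) {s : S}
    {ω : Episode S A} (h : M.episodeProb q s ω ≠ 0) : M.episodeProb q' s ω ≠ 0 := by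
  unfold episodeProb at h ⊢
  split_ifs at h ⊢ with hc
  · rw [Finset.prod_ne_zero_iff] at h ⊢
    exact fun t ht => mul_ne_zero (hq' _ _) (right_ne_zero_of_mul (h t ht))
  · exact absurd rfl h

theorem none_notMem_support {q : S → PMF A} {K : ℝ}
    (hK : ∀ ω ∈ (M.episodeLaw q).support, episodeLength ω ≤ ENNReal.ofReal K) :
    none ∉ (M.episodeLaw q).support := fun h => by simpa [episodeLength] using hK none h

theorem support_episodeLaw_subset {q q' : S → PMF A} (hq' : ∀ s a, q' s a ≠ 0)
    (hnone : none ∉ (M.episodeLaw q).support) :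
    (M.episodeLaw q).support ⊆ (M.episodeLaw q').support := by
  rintro (_ | ω) h
  · exact absurd h hnone
  · exact (PMF.mem_support_iff _ _).2 (M.episodeProb_ne_zero hq' ((PMF.mem_support_iff _ _).1 h))

theorem finite_support_episodeLaw [Finite S] [Finite A] {q : S → PMF A} {K : ℝ} (hK₀ : 0 ≤ K)
    (hK : ∀ ω ∈ (M.episodeLaw q).support, episodeLength ω ≤ ENNReal.ofReal K) :
    (M.episodeLaw q).support.Finite := by
  let f : (Σ n : Fin (⌊K⌋₊ + 1), (Fin (n + 1) → S) × (Fin n → A)) → Option (Episode S A) :=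
    fun ω => some ⟨ω.1, ω.2⟩
  refine (Set.finite_range f).subset ?_
  rintro (_ | ⟨n, ω⟩) h
  · exact absurd h (M.none_notMem_support hK)
  · have h1 := hK _ h
    simp only [episodeLength] at h1
    rw [← ENNReal.ofReal_natCast, ENNReal.ofReal_le_ofReal_iff hK₀] at h1
    exact ⟨⟨⟨n, Nat.lt_succ_of_le (Nat.le_floor h1)⟩, ω⟩, rfl⟩

end EpisodicMDP

/-! ### From episodes to a likelihood model. -/

section Model

variable {S A : Type*} {d : ℕ} (M : EpisodicMDP S A) {π : Param d → S → PMF A}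

open EpisodicMDP

theorem toReal_policy_eq_exp (hpos : ∀ θ s a, π θ s a ≠ 0) (θ : Param d) (s : S) (a : A) :
    (π θ s a).toReal = Real.exp (logPolicy π s a θ) :=
  (Real.exp_log (ENNReal.toReal_pos (hpos θ s a) ((π θ s).apply_ne_top a))).symm

open Classical in
/-- The likelihood of a possible episode is a constant times the exponential of the sum of the
log-policies along it. -/
theorem exists_toReal_episodeProb_eq (hpos : ∀ θ s a, π θ s a ≠ 0) (ω : Episode S A) (s₀ : S) :
    ∃ c : ℝ, ∀ θ, (M.episodeProb (π θ) s₀ ω).toReal =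
      c * Real.exp (∑ t : Fin ω.1, logPolicy π (ω.2.1 t.castSucc) (ω.2.2 t) θ) := by
  unfold episodeProb
  split_ifs with h
  · refine ⟨∏ t : Fin ω.1,
      (M.trans (ω.2.1 t.castSucc) (ω.2.2 t) (ω.2.1 t.succ)).toReal, fun θ => ?_⟩
    simp_rw [Finset.prod_mul_distrib, ENNReal.toReal_mul, ENNReal.toReal_prod,
      toReal_policy_eq_exp hpos, Real.exp_sum]
    exact mul_comm _ _
  · exact ⟨0, by simp⟩

/-- The likelihood-ratio identity: transition factors are free of `θ`, so only the log-policies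
contribute to the logarithmic derivative. -/
theorem hasGradientAt_toReal_episodeLaw (hpos : ∀ θ s a, π θ s a ≠ 0)
    (hdiff : ∀ s a, Differentiable ℝ (logPolicy π s a)) (ω : Episode S A) (θ : Param d) :
    HasGradientAt (fun θ => (M.episodeLaw (π θ) (some ω)).toReal)
      ((M.episodeLaw (π θ) (some ω)).toReal • episodeScore π θ (some ω)) θ := by
  obtain ⟨c, hc⟩ := exists_toReal_episodeProb_eq M hpos ω M.start
  change HasGradientAt (fun θ => (M.episodeProb (π θ) M.start ω).toReal)
    ((M.episodeProb (π θ) M.start ω).toReal • episodeScore π θ (some ω)) θ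
  simp_rw [hc]
  rw [hasGradientAt_iff_hasFDerivAt]
  have h := ((HasFDerivAt.fun_sum (u := Finset.univ) fun (t : Fin ω.1) _ =>
    (hdiff (ω.2.1 t.castSucc) (ω.2.2 t) θ).hasGradientAt.hasFDerivAt).exp).const_mul c
  refine h.congr_fderiv ?_
  ext v
  simp [episodeScore, mul_assoc]

theorem length_le_of_mem_support {q : S → PMF A} {K : ℝ} (hK₀ : 0 ≤ K)
    (hK : ∀ ω ∈ (M.episodeLaw q).support, episodeLength ω ≤ ENNReal.ofReal K) {ω : Episode S A}
    (hω : some ω ∈ (M.episodeLaw q).support) : (ω.1 : ℝ) ≤ K := by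
  have h1 := hK _ hω
  simp only [episodeLength] at h1
  rwa [← ENNReal.ofReal_natCast, ENNReal.ofReal_le_ofReal_iff hK₀] at h1

theorem norm_episodeScore_le {Md : ℝ} (hgrad : ∀ θ s a, ‖gradient (logPolicy π s a) θ‖ ≤ Md)
    (ω : Episode S A) (θ : Param d) : ‖episodeScore π θ (some ω)‖ ≤ ω.1 * Md := by
  simpa [episodeScore] using norm_sum_le_of_le (Finset.univ : Finset (Fin ω.1))
    fun t _ => hgrad θ (ω.2.1 t.castSucc) (ω.2.2 t)

theorem hasFDerivAt_episodeScore
    (hdiff₂ : ∀ s a, Differentiable ℝ (gradient (logPolicy π s a))) (ω : Episode S A)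
    (θ : Param d) : HasFDerivAt (fun θ => episodeScore π θ (some ω))
      (∑ t : Fin ω.1, fderiv ℝ (gradient (logPolicy π (ω.2.1 t.castSucc) (ω.2.2 t))) θ) θ :=
  HasFDerivAt.fun_sum fun t _ => (hdiff₂ (ω.2.1 t.castSucc) (ω.2.2 t) θ).hasFDerivAt

theorem norm_fderiv_episodeScore_le {Mh : ℝ}
    (hdiff₂ : ∀ s a, Differentiable ℝ (gradient (logPolicy π s a)))
    (hhess : ∀ θ s a, ‖fderiv ℝ (gradient (logPolicy π s a)) θ‖ ≤ Mh)
    (ω : Episode S A) (θ : Param d) :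
    ‖fderiv ℝ (fun θ => episodeScore π θ (some ω)) θ‖ ≤ ω.1 * Mh := by
  rw [(hasFDerivAt_episodeScore hdiff₂ ω θ).fderiv]
  simpa using norm_sum_le_of_le (Finset.univ : Finset (Fin ω.1))
    fun t _ => hhess θ (ω.2.1 t.castSucc) (ω.2.2 t)

/-- The laws of the episodes form a likelihood model on their common finite support. -/
theorem exists_likelihoodModel {Me Md Mh : ℝ} (hMe : 0 ≤ Me) (hMd : 0 ≤ Md) (hMh : 0 ≤ Mh)
    (hT : ∀ θ, ∀ ω ∈ (M.episodeLaw (π θ)).support, episodeLength ω ≤ ENNReal.ofReal Me)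
    (hpos : ∀ θ s a, π θ s a ≠ 0)
    (hdiff : ∀ s a, Differentiable ℝ (logPolicy π s a))
    (hdiff₂ : ∀ s a, Differentiable ℝ (gradient (logPolicy π s a)))
    (hgrad : ∀ θ s a, ‖gradient (logPolicy π s a) θ‖ ≤ Md)
    (hhess : ∀ θ s a, ‖fderiv ℝ (gradient (logPolicy π s a)) θ‖ ≤ Mh)
    (s : Set (Option (Episode S A))) [Fintype s]
    (hs : ∀ θ, (M.episodeLaw (π θ)).support = s) :
    ∃ P : LikelihoodModel (Param d) s (Me * Md) (Me * Mh),
      (∀ θ, P.prob θ = fun ω : s => (M.episodeLaw (π θ) ω).toReal) ∧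
      ∀ ω : s, P.score ω = fun θ => episodeScore π θ ω := by
  have hsome : ∀ o : s, ∃ ω : Episode S A, o.1 = some ω ∧ (ω.1 : ℝ) ≤ Me := by
    rintro ⟨_ | ω, ho⟩
    · exact absurd (hs 0 ▸ ho) (M.none_notMem_support (hT 0))
    · exact ⟨ω, rfl, length_le_of_mem_support M hMe (hT 0) (hs 0 ▸ ho)⟩
  refine ⟨{
    prob := fun θ ω => (M.episodeLaw (π θ) ω).toReal
    score := fun ω θ => episodeScore π θ ω
    prob_pos := fun θ ω => ENNReal.toReal_pos
      ((PMF.mem_support_iff _ _).1 ((hs θ).symm ▸ ω.2)) (PMF.apply_ne_top _ _)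
    sum_prob := fun θ => ?_
    hasGradientAt := fun θ o => ?_
    differentiable_score := fun o θ => ?_
    norm_score_le := fun o θ => ?_
    norm_fderiv_score_le := fun o θ => ?_ }, fun _ => rfl, fun _ => rfl⟩
  · have h : ∑' ω : s, M.episodeLaw (π θ) ω = 1 :=
      (tsum_subtype_eq_of_support_subset (hs θ).subset).trans (PMF.tsum_coe _)
    rw [← ENNReal.toReal_sum fun ω _ => PMF.apply_ne_top _ _, ← ENNReal.toReal_one, ← h,
      tsum_fintype]
  all_goals obtain ⟨ω, ho, hω⟩ := hsome o; simp only [ho]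
  · exact hasGradientAt_toReal_episodeLaw M hpos hdiff ω θ
  · exact (hasFDerivAt_episodeScore hdiff₂ ω θ).differentiableAt
  · exact (norm_episodeScore_le hgrad ω θ).trans (mul_le_mul_of_nonneg_right hω hMd)
  · exact (norm_fderiv_episodeScore_le hdiff₂ hhess ω θ).trans
      (mul_le_mul_of_nonneg_right hω hMh)

variable {s : Set (Option (Episode S A))} [Fintype s] {K₁ K₂ : ℝ}
  {P : LikelihoodModel (Param d) s K₁ K₂}

theorem rewardCDF_eq_eventProb (hs : ∀ θ, (M.episodeLaw (π θ)).support = s)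
    (hP : ∀ θ, P.prob θ = fun ω : s => (M.episodeLaw (π θ) ω).toReal) (γ x : ℝ) (θ : Param d) :
    M.rewardCDF (π θ) γ x =
      P.eventProb (sublevel (fun ω : s => M.discountedReward γ ω) x) θ := by
  classical
  set f : Option (Episode S A) → ℝ≥0∞ :=
    (M.discountedReward γ ⁻¹' Set.Iic x).indicator (M.episodeLaw (π θ)) with hf
  have hsupp : Function.support f ⊆ s := by
    rw [Set.support_indicator, ← hs θ]
    exact Set.inter_subset_right
  have htop : ∀ ω, f ω ≠ ⊤ := fun ω =>
    ((Set.indicator_le_self _ _ ω).trans_lt (PMF.apply_lt_top _ ω)).ne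
  rw [rewardCDF, ProbabilityTheory.cdf_eq_real, MeasureTheory.measureReal_def,
    PMF.toMeasure_apply_eq_toOuterMeasure_apply _ measurableSet_Iic, PMF.toOuterMeasure_map_apply,
    PMF.toOuterMeasure_apply, ← hf, ← tsum_subtype_eq_of_support_subset hsupp, tsum_fintype,
    ENNReal.toReal_sum fun (ω : s) _ => htop ω, LikelihoodModel.eventProb, hP, sublevel,
    Finset.sum_filter]
  refine Finset.sum_congr rfl fun ω _ => ?_
  simp only [hf, Set.indicator_apply, Set.mem_preimage, Set.mem_Iic]
  split_ifs <;> simp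

/-- The distortion risk measure as a weighted sum of distorted event probabilities. -/
theorem drm_eq_risk (hs : ∀ θ, (M.episodeLaw (π θ)).support = s)
    (hP : ∀ θ, P.prob θ = fun ω : s => (M.episodeLaw (π θ) ω).toReal) (g : ℝ → ℝ) (γ : ℝ)
    {Mr : ℝ} (hMr : 0 ≤ Mr) (θ : Param d) :
    drm M π g γ Mr θ =
      P.risk g (sublevelWeight (fun ω : s => M.discountedReward γ ω) (-Mr) Mr) θ - Mr := by
  set R : s → ℝ := fun ω => M.discountedReward γ ω
  have hint := fun a b => intervalIntegrable_comp_sublevel R (fun U => g (1 - P.eventProb U θ)) a b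
  unfold drm
  simp_rw [rewardCDF_eq_eventProb M hs hP]
  -- The `-1` on `[-Mr, 0]` integrates to the constant `-Mr`; what remains is one integral over
  -- `[-Mr, Mr]`.
  rw [intervalIntegral.integral_sub (hint _ _) intervalIntegrable_const, sub_add_eq_add_sub,
    intervalIntegral.integral_add_adjacent_intervals (hint _ _) (hint _ _),
    integral_comp_sublevel R (fun U => g (1 - P.eventProb U θ)) (by linarith)]
  simp [LikelihoodModel.risk]

theorem drmGradEstimate_eq_riskGradEstimate
    (hscore : ∀ ω : s, P.score ω = fun θ => episodeScore π θ ω) (g : ℝ → ℝ) (γ : ℝ)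
    {Mr : ℝ} (hMr : 0 ≤ Mr) (θ : Param d) {m : ℕ} (v : Fin m → s) :
    drmGradEstimate M π g γ Mr θ (fun i => v i) = P.riskGradEstimate g
      (sublevelWeight (fun ω : s => M.discountedReward γ ω) (-Mr) Mr) θ v := by
  classical
  set R : s → ℝ := fun ω => M.discountedReward γ ω
  have h1 : ∀ x, empCDF M γ (fun i => (v i : Option (Episode S A))) x =
      LikelihoodModel.empProb v (sublevel R x) := fun x => by
    simp [empCDF, LikelihoodModel.empProb, mem_sublevel, R]
  have h2 : ∀ x, empGradCDF M π γ θ (fun i => (v i : Option (Episode S A))) x =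
      P.empGrad θ v (sublevel R x) := fun x => by
    simp [empGradCDF, LikelihoodModel.empGrad, mem_sublevel, R, hscore]
  unfold drmGradEstimate
  simp_rw [h1, h2]
  rw [integral_comp_sublevel R (fun U => distDeriv g (1 - LikelihoodModel.empProb v U) •
    P.empGrad θ v U) (by linarith)]
  rfl

theorem hasGradientAt_drm (hs : ∀ θ, (M.episodeLaw (π θ)).support = s)
    (hP : ∀ θ, P.prob θ = fun ω : s => (M.episodeLaw (π θ) ω).toReal) {g : ℝ → ℝ} {B₁ B₂ : ℝ}
    (hg : IsSmoothDistortion g B₁ B₂) (γ : ℝ) {Mr : ℝ} (hMr : 0 ≤ Mr) (θ : Param d) :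
    HasGradientAt (drm M π g γ Mr) (P.riskGrad g
      (sublevelWeight (fun ω : s => M.discountedReward γ ω) (-Mr) Mr) θ) θ := by
  rw [funext (drm_eq_risk M hs hP g γ hMr), hasGradientAt_iff_hasFDerivAt]
  exact (P.hasGradientAt_risk hg θ).hasFDerivAt.sub_const Mr

end Model

/-! ### Telescoping along the iterates. -/

section Convergence

variable {S A : Type*} {d : ℕ} (M : EpisodicMDP S A) (π : Param d → S → PMF A) (g : ℝ → ℝ)
  (γ Mr : ℝ)

/-- Serves the small-`N` regime, where the step is too long for the ascent inequality. -/
theorem meanSqGrad_le_of_norm_le {K : ℝ} (hK : ∀ θ, ‖gradient (drm M π g γ Mr) θ‖ ≤ K)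
    (μ : PMF (Param d)) : meanSqGrad M π g γ Mr μ ≤ ENNReal.ofReal (K ^ 2) := by
  calc _ ≤ ∑' θ, μ θ * ENNReal.ofReal (K ^ 2) := by
        unfold meanSqGrad
        gcongr with θ
        exact hK θ
    _ = _ := by rw [ENNReal.tsum_mul_right, PMF.tsum_coe, one_mul]

theorem meanSqGrad_outputLaw (α : ℝ) (m : ℕ) (θ₀ : Param d) (N : ℕ) (hN : 1 ≤ N) :
    meanSqGrad M π g γ Mr (outputLaw M π g γ Mr α m θ₀ N hN) =
      (N : ℝ≥0∞)⁻¹ *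
        ∑ k ∈ Finset.Icc 1 N, meanSqGrad M π g γ Mr (iterateLaw M π g γ Mr α m θ₀ k) := by
  rw [meanSqGrad, outputLaw, PMF.tsum_bind_mul, tsum_eq_sum (s := Finset.Icc 1 N)]
  · rw [Finset.mul_sum]
    refine Finset.sum_congr rfl fun k hk => ?_
    rw [PMF.uniformOfFinset_apply_of_mem _ hk, Nat.card_Icc, Nat.add_sub_cancel]
    rfl
  · intro k hk
    rw [PMF.uniformOfFinset_apply_of_notMem _ hk, zero_mul]

/-- A one-step decrease of the expected gap, averaged along the iterates. -/
theorem sum_meanSqGrad_iterateLaw_le {α β c κ : ℝ} {m : ℕ}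
    (hβ : 0 ≤ β)
    (hstep : ∀ θ, ∑' w, iidLaw (M.episodeLaw (π θ)) m w *
        ENNReal.ofReal (c - drm M π g γ Mr (θ + α • drmGradEstimate M π g γ Mr θ w)) +
        ENNReal.ofReal (β * ‖gradient (drm M π g γ Mr) θ‖ ^ 2) ≤
      ENNReal.ofReal (c - drm M π g γ Mr θ) + ENNReal.ofReal κ) (θ₀ : Param d) (n : ℕ) :
    ENNReal.ofReal β *
        ∑ k ∈ Finset.range n, meanSqGrad M π g γ Mr (iterateLaw M π g γ Mr α m θ₀ k) ≤
      ENNReal.ofReal (c - drm M π g γ Mr θ₀) + n * ENNReal.ofReal κ := by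
  -- The expected optimality gap after `k` steps. Working in `ℝ≥0∞` avoids summability conditions,
  -- and the final gap can simply be dropped.
  let a : ℕ → ℝ≥0∞ := fun k => ∑' θ, iterateLaw M π g γ Mr α m θ₀ k θ *
    ENNReal.ofReal (c - drm M π g γ Mr θ)
  have ha : ∀ k, a (k + 1) +
      ENNReal.ofReal β * meanSqGrad M π g γ Mr (iterateLaw M π g γ Mr α m θ₀ k) ≤
      a k + ENNReal.ofReal κ := by
    intro k
    simp only [a, iterateLaw, meanSqGrad]
    simp_rw [PMF.tsum_bind_mul, PMF.tsum_map_mul]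
    calc _ = ∑' θ, iterateLaw M π g γ Mr α m θ₀ k θ *
          (∑' w, iidLaw (M.episodeLaw (π θ)) m w *
            ENNReal.ofReal (c - drm M π g γ Mr (θ + α • drmGradEstimate M π g γ Mr θ w)) +
          ENNReal.ofReal (β * ‖gradient (drm M π g γ Mr) θ‖ ^ 2)) := by
          simp_rw [mul_add, ENNReal.tsum_add, ← ENNReal.tsum_mul_left, ENNReal.ofReal_mul hβ,
            mul_left_comm]
      _ ≤ ∑' θ, iterateLaw M π g γ Mr α m θ₀ k θ *
          (ENNReal.ofReal (c - drm M π g γ Mr θ) + ENNReal.ofReal κ) := by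
          exact ENNReal.tsum_le_tsum fun θ => mul_le_mul_right (hstep θ) _
      _ = _ := by
          simp_rw [mul_add, ENNReal.tsum_add, ENNReal.tsum_mul_right, PMF.tsum_coe, one_mul]
  have hsum : ∀ n : ℕ, a n + ENNReal.ofReal β *
      ∑ k ∈ Finset.range n, meanSqGrad M π g γ Mr (iterateLaw M π g γ Mr α m θ₀ k) ≤
      a 0 + n * ENNReal.ofReal κ := by
    intro n
    induction n with
    | zero => simp
    | succ n ih =>
      rw [Finset.sum_range_succ, mul_add]
      calc _ = (a (n + 1) + ENNReal.ofReal β *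
            meanSqGrad M π g γ Mr (iterateLaw M π g γ Mr α m θ₀ n)) + ENNReal.ofReal β *
            ∑ k ∈ Finset.range n, meanSqGrad M π g γ Mr (iterateLaw M π g γ Mr α m θ₀ k) := by
            ring
        _ ≤ (a n + ENNReal.ofReal κ) + ENNReal.ofReal β *
            ∑ k ∈ Finset.range n, meanSqGrad M π g γ Mr (iterateLaw M π g γ Mr α m θ₀ k) := by
            exact add_le_add_left (ha n) _
        _ = (a n + ENNReal.ofReal β *
            ∑ k ∈ Finset.range n, meanSqGrad M π g γ Mr (iterateLaw M π g γ Mr α m θ₀ k)) +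
            ENNReal.ofReal κ := by ring
        _ ≤ (a 0 + n * ENNReal.ofReal κ) + ENNReal.ofReal κ := by gcongr
        _ = _ := by push_cast; ring
  have h0 : a 0 = ENNReal.ofReal (c - drm M π g γ Mr θ₀) := PMF.tsum_pure_mul θ₀ _
  exact le_add_self.trans (h0 ▸ hsum n)

theorem meanSqGrad_outputLaw_le {α β c κ : ℝ} {m : ℕ} (hβ : 0 < β) (hκ : 0 ≤ κ)
    (hc : ∀ θ, drm M π g γ Mr θ ≤ c)
    (hstep : ∀ θ, ∑' w, iidLaw (M.episodeLaw (π θ)) m w *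
        ENNReal.ofReal (c - drm M π g γ Mr (θ + α • drmGradEstimate M π g γ Mr θ w)) +
        ENNReal.ofReal (β * ‖gradient (drm M π g γ Mr) θ‖ ^ 2) ≤
      ENNReal.ofReal (c - drm M π g γ Mr θ) + ENNReal.ofReal κ) (θ₀ : Param d) (N : ℕ)
    (hN : 1 ≤ N) :
    meanSqGrad M π g γ Mr (outputLaw M π g γ Mr α m θ₀ N hN) ≤
      ENNReal.ofReal (((c - drm M π g γ Mr θ₀) + (N + 1) * κ) / (β * N)) := by
  have h := sum_meanSqGrad_iterateLaw_le M π g γ Mr hβ.le hstep θ₀ (N + 1)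
  have hN' : (0 : ℝ) < N := by exact_mod_cast hN
  -- The output averages iterates `1` to `N`, while telescoping starts at `0`; including iterate `0`
  -- costs `N + 1` noise terms instead of `N`.
  have hsub : ∑ k ∈ Finset.Icc 1 N, meanSqGrad M π g γ Mr (iterateLaw M π g γ Mr α m θ₀ k) ≤
      ∑ k ∈ Finset.range (N + 1), meanSqGrad M π g γ Mr (iterateLaw M π g γ Mr α m θ₀ k) :=
    Finset.sum_le_sum_of_subset fun k hk => by
      rw [Finset.mem_Icc] at hk
      exact Finset.mem_range.2 (Nat.lt_succ_of_le hk.2)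
  rw [meanSqGrad_outputLaw, ENNReal.ofReal_div_of_pos (by positivity), ENNReal.ofReal_mul hβ.le,
    ENNReal.ofReal_natCast, ENNReal.le_div_iff_mul_le (Or.inl (by positivity))
      (Or.inl (ENNReal.mul_ne_top ENNReal.ofReal_ne_top (ENNReal.natCast_ne_top N))),
    ENNReal.ofReal_add (sub_nonneg.2 (hc θ₀)) (by positivity), ENNReal.ofReal_mul (by positivity),
    ← Nat.cast_add_one, ENNReal.ofReal_natCast]
  refine le_trans ?_ h
  calc _ = ((N : ℝ≥0∞)⁻¹ * N) * (ENNReal.ofReal β * ∑ k ∈ Finset.Icc 1 N,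
        meanSqGrad M π g γ Mr (iterateLaw M π g γ Mr α m θ₀ k)) := by ring
    _ ≤ _ := by
        rw [ENNReal.inv_mul_cancel (by positivity) (ENNReal.natCast_ne_top N), one_mul]
        gcongr

end Convergence

/-! ### The convergence rate. -/

theorem mainTheorem4 {S A : Type*} [Finite S] [Finite A] {d : ℕ}
    (M : EpisodicMDP S A) (π : Param d → S → PMF A) (g : ℝ → ℝ)
    (γ rmax Mr Me Md Mg₁ Mg₂ Mh L C : ℝ)
    (hγ₀ : 0 < γ) (hγ₁ : γ < 1)
    (hrmax : 0 < rmax) (hreward : ∀ s a s', |M.reward s a s'| ≤ rmax)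
    (hMr : Mr = rmax / (1 - γ))
    -- the episode length is almost surely at most `Me`, whatever the parameter
    (hMe : 0 < Me)
    (hT : ∀ θ, ∀ ω ∈ (M.episodeLaw (π θ)).support,
      EpisodicMDP.episodeLength ω ≤ ENNReal.ofReal Me)
    -- `log π_θ(a | s)` is defined, twice differentiable, with bounded gradient and Hessian
    (hpos : ∀ θ s a, π θ s a ≠ 0)
    (hdiff : ∀ s a, Differentiable ℝ (logPolicy π s a))
    (hdiff₂ : ∀ s a, Differentiable ℝ (gradient (logPolicy π s a)))
    (hMd : 0 < Md) (hgrad : ∀ θ s a, ‖gradient (logPolicy π s a) θ‖ ≤ Md)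
    (hMh : 0 < Mh) (hhess : ∀ θ s a, ‖fderiv ℝ (gradient (logPolicy π s a)) θ‖ ≤ Mh)
    -- the distortion function is twice differentiable on `(0,1)`, with bounded derivatives,
    -- and has a right derivative at `0`
    (hg : IsDistortion g)
    (hg₀ : DifferentiableWithinAt ℝ g (Set.Icc 0 1) 0)
    (hg₁ : ∀ t ∈ Set.Ioo (0 : ℝ) 1, DifferentiableAt ℝ g t)
    (hg₂ : ∀ t ∈ Set.Ioo (0 : ℝ) 1, DifferentiableAt ℝ (deriv g) t)
    (hMg₁ : 0 < Mg₁) (hg₁_le : ∀ t ∈ Set.Ioo (0 : ℝ) 1, |deriv g t| ≤ Mg₁)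
    (hMg₂ : 0 < Mg₂) (hg₂_le : ∀ t ∈ Set.Ioo (0 : ℝ) 1, |deriv (deriv g) t| ≤ Mg₂)
    (hL : L = 2 * Mr * Me * (Mh * Mg₁ + Me * Md ^ 2 * (Mg₁ + Mg₂)))
    (θ₀ : Param d)
    (hC : C = 2 * ((⨆ θ, drm M π g γ Mr θ) - drm M π g γ Mr θ₀) +
      4 * Mr ^ 2 * Me ^ 2 * Md ^ 2 *
        (Mg₁ ^ 2 * L + 8 * (Real.exp 1 ^ 2 * Mg₁ ^ 2 + Mg₂ ^ 2))) :
    Differentiable ℝ (drm M π g γ Mr) ∧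
    BddAbove (Set.range (drm M π g γ Mr)) ∧
    (∀ (N : ℕ) (hN : 1 ≤ N),
      meanSqGrad M π g γ Mr
          (outputLaw M π g γ Mr (1 / √(N : ℝ)) ⌈√(N : ℝ)⌉₊ θ₀ N hN) ≤
        ENNReal.ofReal (C / √(N : ℝ))) ∧
    (∀ ε : ℝ, 0 < ε → ∀ (N : ℕ) (hN : 1 ≤ N), C ^ 2 / ε ^ 2 ≤ (N : ℝ) →
      IsStationaryPoint M π g γ Mr ε
        (outputLaw M π g γ Mr (1 / √(N : ℝ)) ⌈√(N : ℝ)⌉₊ θ₀ N hN)) := by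
  classical
  have hMr₀ : 0 < Mr := hMr ▸ div_pos hrmax (sub_pos.2 hγ₁)
  have hG : IsSmoothDistortion g Mg₁ Mg₂ :=
    { hg with
      hasDerivAt := fun t ht => distDeriv_eq_deriv (g := g) ht ▸ (hg₁ t ht).hasDerivAt
      abs_deriv_le := fun t ht => abs_distDeriv_le hg₀ hg₁ hg₁_le ht
      abs_deriv_sub_le := fun s hs t ht =>
        abs_distDeriv_sub_le hg₀ hg₁ hg₂ hMg₂.le hg₂_le hs ht
      bound_nonneg := hMg₁.le
      lipschitz_nonneg := hMg₂.le }
  have hsub : ∀ θ θ', (M.episodeLaw (π θ)).support ⊆ (M.episodeLaw (π θ')).support := fun θ θ' =>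
    M.support_episodeLaw_subset (hpos θ') (M.none_notMem_support (hT θ))
  let s : Set (Option (Episode S A)) := (M.episodeLaw (π θ₀)).support
  have hs : ∀ θ, (M.episodeLaw (π θ)).support = s := fun θ => (hsub θ θ₀).antisymm (hsub θ₀ θ)
  have : Fintype s := (M.finite_support_episodeLaw hMe.le (hT θ₀)).fintype
  obtain ⟨P, hP, hscore⟩ := exists_likelihoodModel M hMe.le hMd.le hMh.le hT hpos hdiff hdiff₂
    hgrad hhess s hs
  set w := sublevelWeight (fun ω : s => M.discountedReward γ ω) (-Mr) Mr with hw_def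
  have hw : ∀ U, 0 ≤ w U := sublevelWeight_nonneg _ _ _
  have hW : ∑ U, w U = 2 * Mr := by
    rw [hw_def, sum_sublevelWeight _ (by linarith)]; ring
  have hρ : ∀ θ, drm M π g γ Mr θ = P.risk g w θ - Mr := drm_eq_risk M hs hP g γ hMr₀.le
  have hρ' : ∀ θ, HasGradientAt (drm M π g γ Mr) (P.riskGrad g w θ) θ :=
    hasGradientAt_drm M hs hP hG γ hMr₀.le
  have hgr : ∀ θ, gradient (drm M π g γ Mr) θ = P.riskGrad g w θ := fun θ => (hρ' θ).gradient
  have hbdd : BddAbove (Set.range (drm M π g γ Mr)) := by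
    refine ⟨Mr, ?_⟩
    rintro _ ⟨θ, rfl⟩
    have := P.risk_le hG hw θ
    rw [hρ]
    linarith
  set c := ⨆ θ, drm M π g γ Mr θ with hc_def
  have hc : ∀ θ, drm M π g γ Mr θ ≤ c := le_ciSup hbdd
  have hK₁ : 0 ≤ Me * Md := by positivity
  have hK₂ : 0 ≤ Me * Mh := by positivity
  have hL' : L = (∑ U, w U) * (Mg₁ * (Me * Mh + (Me * Md) ^ 2) + Mg₂ * (Me * Md) ^ 2) := by
    rw [hW, hL]; ring
  have hL₀ : 0 < L := hL ▸ by positivity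
  have hexp : (1 : ℝ) ≤ Real.exp 1 ^ 2 := one_le_pow₀ (Real.one_le_exp zero_le_one)
  have hgap : 0 ≤ c - drm M π g γ Mr θ₀ := sub_nonneg.2 (hc θ₀)
  have hmain : ∀ (N : ℕ) (hN : 1 ≤ N), meanSqGrad M π g γ Mr
      (outputLaw M π g γ Mr (1 / √(N : ℝ)) ⌈√(N : ℝ)⌉₊ θ₀ N hN) ≤
      ENNReal.ofReal (C / √(N : ℝ)) := by
    intro N hN
    have hN' : (1 : ℝ) ≤ N := by exact_mod_cast hN
    have hsq : √(N : ℝ) ^ 2 = N := Real.sq_sqrt (by linarith)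
    have hr : 0 < √(N : ℝ) := Real.sqrt_pos.2 (by linarith)
    set r := √(N : ℝ) with hr_def
    have hm : 1 ≤ ⌈r⌉₊ := Nat.one_le_ceil_iff.2 hr
    have hmr : r ≤ (⌈r⌉₊ : ℝ) := Nat.le_ceil r
    rcases le_total r L with hle | hle
    -- Here `r ≤ L`: the squared gradient is at most `(2 * Mr * Mg₁ * Me * Md) ^ 2`, and the `Mg₁ ^
    -- 2 * L` term of `C` covers `r` times this.
    · refine (meanSqGrad_le_of_norm_le M π g γ Mr (fun θ => (hgr θ).symm ▸
        P.norm_riskGrad_le hG hw hK₁ θ) _).trans (ENNReal.ofReal_le_ofReal ?_)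
      rw [hW, le_div_iff₀ hr, hC]
      have h1 : 4 * Mr ^ 2 * Me ^ 2 * Md ^ 2 * Mg₁ ^ 2 * r ≤
          4 * Mr ^ 2 * Me ^ 2 * Md ^ 2 * Mg₁ ^ 2 * L := by gcongr
      have h2 : 0 ≤ 4 * Mr ^ 2 * Me ^ 2 * Md ^ 2 *
          (8 * (Real.exp 1 ^ 2 * Mg₁ ^ 2 + Mg₂ ^ 2)) := by positivity
      linarith
    set V := (∑ U, w U) ^ 2 * (Me * Md) ^ 2 * (2 * (Mg₁ ^ 2 + Mg₂ ^ 2)) with hV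
    have hV₀ : 0 ≤ V := by positivity
    have hstep : ∀ θ, ∑' v, iidLaw (M.episodeLaw (π θ)) ⌈r⌉₊ v *
        ENNReal.ofReal (c - drm M π g γ Mr (θ + (1 / r) • drmGradEstimate M π g γ Mr θ v)) +
        ENNReal.ofReal (1 / r / 2 * ‖gradient (drm M π g γ Mr) θ‖ ^ 2) ≤
      ENNReal.ofReal (c - drm M π g γ Mr θ) + ENNReal.ofReal (1 / r / 2 * (V / ⌈r⌉₊)) := by
      intro θ
      rw [tsum_iidLaw_mul _ s (hs θ).subset _ _ fun _ => sub_nonneg.2 (hc _), ← hP θ,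
        ← ENNReal.ofReal_add _ (by positivity),
        ← ENNReal.ofReal_add (sub_nonneg.2 (hc θ)) (by positivity)]
      · refine ENNReal.ofReal_le_ofReal ?_
        -- The shift to `c + Mr` compensates for `drm` being the risk minus `Mr`.
        have h := P.iidExpectation_gap_step_le hG hw hK₁ hK₂ (α := 1 / r) (by positivity)
          (by rw [← hL', one_div_mul_eq_div]; exact (div_le_one hr).2 hle) (c + Mr) θ hm
        simp_rw [drmGradEstimate_eq_riskGradEstimate M hscore g γ hMr₀.le, hgr, hρ,
          sub_sub_eq_add_sub]
        exact h
      · refine Finset.sum_nonneg fun v _ => mul_nonneg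
          (Finset.prod_nonneg fun i _ => (P.prob_pos θ _).le) (sub_nonneg.2 (hc _))
    refine (meanSqGrad_outputLaw_le M π g γ Mr (by positivity) (by positivity) hc hstep θ₀ N
      hN).trans (ENNReal.ofReal_le_ofReal ?_)
    -- `N + 1 ≤ 2 * N` absorbs the extra noise term, and rounding the batch size up only helps.
    have h1 : ((N : ℝ) + 1) * (V / ⌈r⌉₊) ≤ (2 * N) * (V / r) := by
      gcongr
      linarith
    -- The constant in `C` is not tight: the variance argument needs only `4` and `1` in place of
    -- `8` and `Real.exp 1 ^ 2`.
    have h2 : 2 * V ≤ 4 * Mr ^ 2 * Me ^ 2 * Md ^ 2 *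
        (Mg₁ ^ 2 * L + 8 * (Real.exp 1 ^ 2 * Mg₁ ^ 2 + Mg₂ ^ 2)) := by
      have h3 : 2 * V = 4 * Mr ^ 2 * Me ^ 2 * Md ^ 2 * (4 * (1 * Mg₁ ^ 2 + Mg₂ ^ 2)) := by
        rw [hV, hW]; ring
      rw [h3]
      gcongr
      have : 0 ≤ Mg₁ ^ 2 * L := by positivity
      have h4 : 1 * Mg₁ ^ 2 ≤ Real.exp 1 ^ 2 * Mg₁ ^ 2 := by gcongr
      nlinarith [sq_nonneg Mg₁, sq_nonneg Mg₂]
    calc (c - drm M π g γ Mr θ₀ + (N + 1) * (1 / r / 2 * (V / ⌈r⌉₊))) / (1 / r / 2 * N)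
        = (2 * r * (c - drm M π g γ Mr θ₀) + (N + 1) * (V / ⌈r⌉₊)) / N := by
          field_simp
      _ ≤ (2 * r * (c - drm M π g γ Mr θ₀) + (2 * N) * (V / r)) / N := by gcongr
      _ = (2 * (c - drm M π g γ Mr θ₀) + 2 * V) / r := by
          rw [← hsq]; field_simp
      _ ≤ C / r := by rw [hC]; gcongr
  refine ⟨fun θ => (hρ' θ).hasFDerivAt.differentiableAt, hbdd, hmain, fun ε hε N hN hNε => ?_⟩
  refine (hmain N hN).trans (ENNReal.ofReal_le_ofReal ?_)
  have hr : 0 < √(N : ℝ) := Real.sqrt_pos.2 (by exact_mod_cast hN)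
  rw [div_le_iff₀ hr, ← div_le_iff₀' hε]
  exact Real.le_sqrt_of_sq_le (by rwa [div_pow])
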